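/- Let $X_1,X_2,\ldots$ be i.i.d. random elements of a measurable space $\mathcal X$ and let $h:\mathcal X^2\to\mathbb R$ be a symmetric measurable kernel with $\mathbb E|h(X_1,X_2)|^4<\infty$. Put $\theta=\mathbb E\,h(X_1,X_2)$, $h_1(x)=\mathbb E\{h(x,X_2)\}-\theta$, $\sigma^2=\mathrm{Var}\{h_1(X_1)\}$, and for $n\ge 2$ $$U_n=\binom n2^{-1}\sum_{1\le i<j\le n}h(X_i,X_j),\qquad \widehat\sigma_n^2=\frac1n\sum_{i=1}^n\Bigl\{\frac1{n-1}\sum_{1\le j\le n,\ j\ne i}h(X_i,X_j)\Bigr\}^2-U_n^2 .$$ Then $\widehat\sigma_n^2$ is strongly consistent, that is, $\widehat\sigma_n^2\to\sigma^2$ almost surely, with the rate $$\bigl|\widehat\sigma_n^2-\sigma^2\bigr|=\mathcal O_{a.s.}\bigl(\sqrt{\log\log n/n}\bigr),$$ meaning that, almost surely, there is a finite (possibly random) constant $C$ with $|\widehat\sigma_n^2-\sigma^2|\le C\sqrt{\log\log n/n}$ for all sufficiently large $n$. -/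

import Mathlib

open MeasureTheory ProbabilityTheory Filter Asymptotics Topology

noncomputable section

namespace JackknifeU

/-- The parameter `θ = E h(X₁, X₂)`. The sequence is indexed from `0`, so that the first two
observations are `X 0` and `X 1`. -/
def theta {Ω 𝓧 : Type*} [MeasurableSpace Ω] (P : Measure Ω) (X : ℕ → Ω → 𝓧)
    (h : 𝓧 → 𝓧 → ℝ) : ℝ :=
  ∫ ω, h (X 0 ω) (X 1 ω) ∂P

/-- The first-order projection `h₁(x) = E h(x, X₂) - θ`. -/
def firstProj {Ω 𝓧 : Type*} [MeasurableSpace Ω] (P : Measure Ω) (X : ℕ → Ω → 𝓧)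
    (h : 𝓧 → 𝓧 → ℝ) (x : 𝓧) : ℝ :=
  (∫ ω, h x (X 1 ω) ∂P) - theta P X h

/-- `σ² = Var h₁(X₁)`. -/
def sigmaSq {Ω 𝓧 : Type*} [MeasurableSpace Ω] (P : Measure Ω) (X : ℕ → Ω → 𝓧)
    (h : 𝓧 → 𝓧 → ℝ) : ℝ :=
  variance (fun ω => firstProj P X h (X 0 ω)) P

/-- The U-statistic of degree two of the first `n` terms of the data sequence `x`: the average of
`h (x i) (x j)` over the pairs `i < j < n`. -/
def uStat {𝓧 : Type*} (h : 𝓧 → 𝓧 → ℝ) (x : ℕ → 𝓧) (n : ℕ) : ℝ :=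
  ((n.choose 2 : ℕ) : ℝ)⁻¹ * ∑ j ∈ Finset.range n, ∑ i ∈ Finset.range j, h (x i) (x j)

/-- The jackknife variance estimator computed from the first `n` terms of the data sequence `x`. -/
def jackknifeVar {𝓧 : Type*} (h : 𝓧 → 𝓧 → ℝ) (x : ℕ → 𝓧) (n : ℕ) : ℝ :=
  (1 / (n : ℝ)) * ∑ i ∈ Finset.range n,
      ((1 / ((n : ℝ) - 1)) * ∑ j ∈ (Finset.range n).erase i, h (x i) (x j)) ^ 2
    - uStat h x n ^ 2

end JackknifeU

end

/-! Write the Hoeffding decomposition `h(x,y) = θ + g(x) + g(y) + ψ(x,y)`, with `g` centred and `ψ`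
degenerate (both conditional means vanish). By symmetry `U_n` is the average of the row means
`(n-1)⁻¹ ∑_{j≠i} h(X_i,X_j)`, so the estimator is the empirical variance of these row means, and the
part common to all rows cancels. What remains (`jackknifeVar_eq`) is, up to factors tending to 1,
the mean of `g(X_i)²`, a cross term in `g(X_i) ψ(X_i,X_j)`, a mean of squared row sums of `ψ`, and
the square of a centred mean.

The mean of `g²` is an i.i.d. mean of square-integrable variables, since `g` has four moments; the
law of the iterated logarithm (`isBigO_sum_lil`) gives exactly the claimed rate. The cross kernel
`g(x) ψ(x,y)` is a degenerate kernel plus a centred function of `y` alone; the latter again obeys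
the LIL.

Degenerate kernels need only crude bounds: `n^{3/2}` for the double sum (`isBigO_degenerate_sum`)
and `n^{5/2}` for the sum of squared row sums (`isBigO_sum_sq_degenerate`). Both normalise to
`n^{-1/2}`, which is below the LIL rate. They follow from orthogonality, the Rademacher–Menshov
inequality and summable expectations over dyadic blocks; the logarithmic loss is absorbed by a
geometric factor. -/

noncomputable section

namespace JackknifeU

/-! ### Exponential maximal inequality for bounded independent summands -/

section Maximal

variable {Ω : Type*} [MeasurableSpace Ω] {P : Measure Ω}

/-- Integrate `exp x ≤ 1 + x + x²`, valid for `|x| ≤ 1`; the linear term has mean zero. -/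
lemma mgf_le_exp_of_bounded [IsProbabilityMeasure P] {Z : Ω → ℝ} (hZ : Measurable Z)
    {K v t : ℝ} (ht : 0 ≤ t) (hK : ∀ ω, |Z ω| ≤ K) (htK : t * K ≤ 1) (hmean : ∫ ω, Z ω ∂P = 0)
    (hvar : ∫ ω, Z ω ^ 2 ∂P ≤ v) :
    mgf Z P t ≤ Real.exp (t ^ 2 * v) := by
  have hint : Integrable Z P :=
    Integrable.of_bound hZ.aestronglyMeasurable K (ae_of_all _ fun ω => by simpa using hK ω)
  have hint2 : Integrable (fun ω => Z ω ^ 2) P :=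
    Integrable.of_bound (hZ.pow_const 2).aestronglyMeasurable (K ^ 2) (ae_of_all _ fun ω => by
      rw [Real.norm_eq_abs, abs_pow]
      exact pow_le_pow_left₀ (abs_nonneg _) (hK ω) 2)
  have hb : ∀ ω, Real.exp (t * Z ω) ≤ 1 + t * Z ω + t ^ 2 * Z ω ^ 2 := fun ω => by
    have h1 : |t * Z ω| ≤ 1 := by
      rw [abs_mul, abs_of_nonneg ht]
      exact (mul_le_mul_of_nonneg_left (hK ω) ht).trans htK
    have h2 := (abs_le.mp (Real.abs_exp_sub_one_sub_id_le h1)).2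
    nlinarith [h2]
  have hint3 : Integrable (fun ω => 1 + t * Z ω + t ^ 2 * Z ω ^ 2) P :=
    ((integrable_const 1).add (hint.const_mul t)).add (hint2.const_mul _)
  calc mgf Z P t ≤ ∫ ω, (1 + t * Z ω + t ^ 2 * Z ω ^ 2) ∂P :=
        integral_mono_of_nonneg (ae_of_all _ fun ω => (Real.exp_pos _).le) hint3 (ae_of_all _ hb)
    _ = 1 + t ^ 2 * ∫ ω, Z ω ^ 2 ∂P := by
        rw [integral_add (f := fun ω => 1 + t * Z ω) (g := fun ω => t ^ 2 * Z ω ^ 2)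
            ((integrable_const 1).add (hint.const_mul t)) (hint2.const_mul _),
          integral_add (integrable_const 1) (hint.const_mul t), integral_const_mul,
          integral_const_mul, hmean]
        simp
    _ ≤ 1 + t ^ 2 * v := by gcongr
    _ ≤ Real.exp (t ^ 2 * v) := by linarith [Real.add_one_le_exp (t ^ 2 * v)]

/-- Doob's maximal inequality for the submartingale `exp (t S_n)`. The factors have mean at least 1
because `exp x ≥ 1 + x` and the summands are centred. -/
lemma measure_exists_sum_ge_le_exp [IsProbabilityMeasure P] {Z : ℕ → Ω → ℝ}
    (hZ : ∀ i, Measurable (Z i)) (hind : iIndepFun Z P) {K v t : ℝ} (ht : 0 ≤ t)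
    (hK : ∀ i ω, |Z i ω| ≤ K) (htK : t * K ≤ 1) (hmean : ∀ i, ∫ ω, Z i ω ∂P = 0)
    (hvar : ∀ i, ∫ ω, Z i ω ^ 2 ∂P ≤ v) (N : ℕ) {a : ℝ} (ha : 0 < a) :
    P {ω | ∃ n ≤ N, a ≤ ∑ i ∈ Finset.range n, Z i ω} ≤
      ENNReal.ofReal (Real.exp (N * (t ^ 2 * v) - t * a)) := by
  rcases N with _ | N
  · have : {ω | ∃ n ≤ 0, a ≤ ∑ i ∈ Finset.range n, Z i ω} = (∅ : Set Ω) := by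
      ext ω; simp [ha]
    rw [this]; simp
  set s : ℕ → Ω → ℝ := fun i ω => Real.exp (t * Z i ω) with hs
  have hsm : ∀ i, Measurable (s i) := fun i => ((hZ i).const_mul t).exp
  have hsind : iIndepFun s P :=
    hind.comp (fun _ x => Real.exp (t * x)) fun _ => by fun_prop
  -- The index is shifted by one: the natural filtration at time `n` already contains `Z 0, …, Z n`.
  -- The lost empty sum cannot reach `a > 0`.
  set f : ℕ → Ω → ℝ := fun n ω => Real.exp (t * ∑ i ∈ Finset.range (n + 1), Z i ω) with hf
  have hfprod : ∀ n, f n = fun ω => ∏ i ∈ Finset.range (n + 1), s i ω := fun n => by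
    funext ω; simp [hf, hs, Finset.mul_sum, Real.exp_sum]
  set 𝒢 := Filtration.natural s (fun i => (hsm i).stronglyMeasurable) with h𝒢
  have hfm : ∀ n, Measurable (f n) := fun n =>
    ((Finset.measurable_fun_sum _ fun i _ => hZ i).const_mul t).exp
  have hfint : ∀ n, Integrable (f n) P := fun n => by
    refine Integrable.of_bound (hfm n).aestronglyMeasurable (Real.exp (n + 1))
      (ae_of_all _ fun ω => ?_)
    rw [Real.norm_eq_abs, abs_of_pos (Real.exp_pos _)]
    refine Real.exp_le_exp.mpr ?_
    rw [Finset.mul_sum]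
    refine (Finset.sum_le_card_nsmul _ _ 1 fun i _ => ?_).trans (by simp)
    exact (mul_le_mul_of_nonneg_left ((le_abs_self _).trans (hK i ω)) ht).trans htK
  have hsint : ∀ n, Integrable (s n) P := fun n => by
    refine Integrable.of_bound (hsm n).aestronglyMeasurable (Real.exp 1)
      (ae_of_all _ fun ω => ?_)
    rw [Real.norm_eq_abs, abs_of_pos (Real.exp_pos _)]
    refine Real.exp_le_exp.mpr ?_
    exact (mul_le_mul_of_nonneg_left ((le_abs_self _).trans (hK n ω)) ht).trans htK
  have hint : ∀ i, Integrable (Z i) P := fun i =>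
    Integrable.of_bound (hZ i).aestronglyMeasurable K (ae_of_all _ fun ω => by simpa using hK i ω)
  have hsge : ∀ i, 1 ≤ ∫ ω, s i ω ∂P := fun i => by
    have : ∫ ω, (t * Z i ω + 1) ∂P ≤ ∫ ω, s i ω ∂P :=
      integral_mono (((hint i).const_mul t).add (integrable_const 1)) (hsint i)
        fun ω => Real.add_one_le_exp _
    rw [integral_add ((hint i).const_mul t) (integrable_const 1), integral_const_mul,
      hmean i] at this
    simpa using this
  have hadp : StronglyAdapted 𝒢 f := fun n => by
    rw [hfprod n]
    refine Finset.stronglyMeasurable_fun_prod _ fun i hi => ?_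
    exact (Filtration.stronglyAdapted_natural
      (fun i => (hsm i).stronglyMeasurable) i).mono
        (𝒢.mono (Nat.lt_succ_iff.mp (Finset.mem_range.mp hi)))
  have hstep : ∀ n, f (n + 1) = f n * s (n + 1) := fun n => by
    funext ω
    rw [hfprod, hfprod, Pi.mul_apply]
    exact Finset.prod_range_succ _ (n + 1)
  have hsub : Submartingale f 𝒢 P := by
    refine submartingale_nat hadp hfint fun n => ?_
    have h1 : P[f (n + 1) | 𝒢 n] =ᵐ[P] f n * P[s (n + 1) | 𝒢 n] := by
      rw [hstep n]
      refine condExp_mul_of_stronglyMeasurable_left (hadp n) ?_ (hsint _)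
      rw [← hstep n]; exact hfint _
    have h2 := hsind.condExp_natural_ae_eq_of_lt (fun i => (hsm i).stronglyMeasurable)
      (Nat.lt_succ_self n)
    filter_upwards [h1, h2] with ω h1 h2
    rw [h1, Pi.mul_apply, h2]
    exact le_mul_of_one_le_right (Real.exp_pos _).le (hsge _)
  have hmax := maximal_ineq hsub (fun n ω => (Real.exp_pos _).le)
    (ε := (Real.exp (t * a)).toNNReal) N
  rw [Real.coe_toNNReal _ (Real.exp_pos _).le] at hmax
  have hIf : ∫ ω, f N ω ∂P ≤ Real.exp ((N + 1 : ℕ) * (t ^ 2 * v)) := by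
    have h1 := hind.mgf_sum (t := t) hZ (Finset.range (N + 1))
    have h2 : ∫ ω, f N ω ∂P = mgf (∑ i ∈ Finset.range (N + 1), Z i) P t := by
      simp [hf, mgf]
    rw [h2, h1, Real.exp_nat_mul]
    refine (Finset.prod_le_prod (fun i _ => mgf_nonneg) fun i _ =>
      mgf_le_exp_of_bounded (hZ i) ht (hK i) htK (hmean i) (hvar i)).trans ?_
    simp
  set E := {ω | (Real.exp (t * a)) ≤ (Finset.range (N + 1)).sup' Finset.nonempty_range_add_one
    fun k => f k ω} with hE
  have hmax' : ENNReal.ofReal (Real.exp (t * a)) * P E ≤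
      ENNReal.ofReal (Real.exp ((N + 1 : ℕ) * (t ^ 2 * v))) := by
    refine hmax.trans (ENNReal.ofReal_le_ofReal ?_)
    exact (setIntegral_le_integral (hfint N) (ae_of_all _ fun ω => (Real.exp_pos _).le)).trans hIf
  have hsubset : {ω | ∃ n ≤ N + 1, a ≤ ∑ i ∈ Finset.range n, Z i ω} ⊆ E := by
    rintro ω ⟨n, hn, han⟩
    rcases n with _ | n
    · simp at han; linarith
    · refine le_trans ?_ (Finset.le_sup' (fun k => f k ω) (b := n)
        (Finset.mem_range.mpr (by omega)))
      exact Real.exp_le_exp.mpr (mul_le_mul_of_nonneg_left han ht)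
  refine (measure_mono hsubset).trans ?_
  rw [Real.exp_sub, ENNReal.ofReal_div_of_pos (Real.exp_pos _), ENNReal.le_div_iff_mul_le
    (Or.inl (by simp [Real.exp_pos])) (Or.inl ENNReal.ofReal_ne_top), mul_comm]
  exact hmax'

end Maximal

/-! ### First-moment Borel–Cantelli and dyadic scales -/

/-- The series `∑ B k` has finite expectation, hence converges almost surely, and its terms tend to
0. -/
lemma ae_eventually_le_one_of_summable {Ω : Type*} [MeasurableSpace Ω] {P : Measure Ω}
    {B : ℕ → Ω → ℝ} (hB : ∀ k, Integrable (B k) P) (h0 : ∀ k ω, 0 ≤ B k ω)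
    (hs : Summable fun k => ∫ ω, B k ω ∂P) :
    ∀ᵐ ω ∂P, ∀ᶠ k in atTop, B k ω ≤ 1 := by
  have h1 : ∫⁻ ω, ∑' k, ENNReal.ofReal (B k ω) ∂P ≠ ⊤ := by
    rw [lintegral_tsum fun k => (hB k).aestronglyMeasurable.aemeasurable.ennreal_ofReal]
    have : ∀ k, ∫⁻ ω, ENNReal.ofReal (B k ω) ∂P = ENNReal.ofReal (∫ ω, B k ω ∂P) := fun k =>
      (ofReal_integral_eq_lintegral_ofReal (hB k) (ae_of_all _ (h0 k))).symm
    simp_rw [this]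
    exact hs.tsum_ofReal_ne_top
  have h2 := ae_lt_top' (AEMeasurable.tsum
    fun k => (hB k).aestronglyMeasurable.aemeasurable.ennreal_ofReal) h1
  filter_upwards [h2] with ω hω
  have h3 := ENNReal.tendsto_atTop_zero_of_tsum_ne_top hω.ne
  have h4 : ∀ᶠ k in atTop, ENNReal.ofReal (B k ω) ≤ 1 :=
    (h3.eventually (ge_mem_nhds (by simp : (0 : ENNReal) < 1)))
  filter_upwards [h4] with k hk
  simpa using hk

/-- The iterated logarithm scale `log (k + 3)`, comparable to `log log n` for `n ≈ 2 ^ k`. -/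
def dyadicLog (k : ℕ) : ℝ := Real.log (k + 3)

/-- The truncation level `√(2 ^ k / log (k + 3))`. -/
def truncLevel (k : ℕ) : ℝ := √(2 ^ k / dyadicLog k)

/-- The dyadic law-of-the-iterated-logarithm rate `√(2 ^ k * log (k + 3))`. -/
def lilRate (k : ℕ) : ℝ := √(2 ^ k * dyadicLog k)

lemma one_lt_dyadicLog (k : ℕ) : 1 < dyadicLog k := by
  rw [dyadicLog, Real.lt_log_iff_exp_lt (by positivity)]
  have := Real.exp_one_lt_d9
  have : (0 : ℝ) ≤ k := k.cast_nonneg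
  linarith

lemma dyadicLog_pos (k : ℕ) : 0 < dyadicLog k := one_pos.trans (one_lt_dyadicLog k)

lemma truncLevel_pos (k : ℕ) : 0 < truncLevel k :=
  Real.sqrt_pos.mpr (div_pos (by positivity) (dyadicLog_pos k))

lemma lilRate_pos (k : ℕ) : 0 < lilRate k :=
  Real.sqrt_pos.mpr (mul_pos (by positivity) (dyadicLog_pos k))

lemma lilRate_mul_truncLevel (k : ℕ) : lilRate k * truncLevel k = 2 ^ k := by
  have := dyadicLog_pos k
  rw [lilRate, truncLevel, ← Real.sqrt_mul (by positivity)]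
  have : (2 : ℝ) ^ k * dyadicLog k * (2 ^ k / dyadicLog k) = (2 ^ k) ^ 2 := by
    field_simp
  rw [this, Real.sqrt_sq (by positivity)]

lemma truncLevel_sq (k : ℕ) : truncLevel k ^ 2 = 2 ^ k / dyadicLog k :=
  Real.sq_sqrt (div_nonneg (by positivity) (dyadicLog_pos k).le)

lemma lilRate_eq (k : ℕ) : lilRate k = truncLevel k * dyadicLog k := by
  have h1 := lilRate_mul_truncLevel k
  have h2 := truncLevel_sq k
  have h3 := dyadicLog_pos k
  have h4 := truncLevel_pos k
  rw [eq_div_iff h3.ne'] at h2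
  refine mul_right_cancel₀ h4.ne' ?_
  rw [h1, ← h2]; ring

/-- The squared ratio of consecutive levels is `log (k+4) / (2 log (k+3)) ≤ 3/4`, because `(k+4)² ≤
(k+3)³`; and `3/4 ≤ (7/8)²`. Geometric growth makes sums of levels comparable to the last one, with
factor `1/(1 - 7/8) = 8`. -/
lemma truncLevel_succ (k : ℕ) : truncLevel k ≤ 7 / 8 * truncLevel (k + 1) := by
  have h4 := truncLevel_pos (k + 1)
  refine le_of_sq_le_sq ?_ (by positivity)
  have h1 := dyadicLog_pos k
  have h2 := dyadicLog_pos (k + 1)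
  have h3 : 2 * dyadicLog (k + 1) ≤ 3 * dyadicLog k := by
    have hk : (0 : ℝ) ≤ k := k.cast_nonneg
    have e1 : 2 * dyadicLog (k + 1) = Real.log (((k : ℝ) + 4) ^ 2) := by
      rw [Real.log_pow, dyadicLog]; push_cast; ring_nf
    have e2 : 3 * dyadicLog k = Real.log (((k : ℝ) + 3) ^ 3) := by
      rw [Real.log_pow, dyadicLog]; push_cast; ring_nf
    rw [e1, e2]
    refine Real.log_le_log (by positivity) ?_
    nlinarith [mul_nonneg hk hk, mul_nonneg hk (mul_nonneg hk hk)]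
  rw [mul_pow, truncLevel_sq, truncLevel_sq, pow_succ (2 : ℝ) k]
  rw [div_le_iff₀ h1]
  have : (7 / 8 : ℝ) ^ 2 * (2 ^ k * 2 / dyadicLog (k + 1)) * dyadicLog k =
    2 ^ k * (49 / 32 * (dyadicLog k / dyadicLog (k + 1))) := by ring
  rw [this]
  refine le_mul_of_one_le_right (by positivity) ?_
  rw [← mul_div_assoc, le_div_iff₀ h2]
  linarith

lemma sum_truncLevel_le (K : ℕ) :
    ∑ k ∈ Finset.range (K + 1), truncLevel k ≤ 8 * truncLevel K := by
  induction K with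
  | zero => simp; linarith [truncLevel_pos 0]
  | succ K ih =>
    rw [Finset.sum_range_succ]
    linarith [truncLevel_succ K]

lemma sum_truncLevel_indicator_le {y : ℝ} (hy : 0 ≤ y) (K : ℕ) :
    ∑ k ∈ Finset.range K, (if truncLevel k < y then truncLevel k else 0) ≤ 8 * y := by
  induction K with
  | zero => simpa using hy
  | succ K ih =>
    by_cases h : truncLevel K < y
    · refine (Finset.sum_le_sum (g := truncLevel) fun k _ => ?_).trans
        ((sum_truncLevel_le K).trans (by linarith))
      split_ifs
      exacts [le_rfl, (truncLevel_pos k).le]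
    · rw [Finset.sum_range_succ, if_neg h, add_zero]
      exact ih

/-- With `k = ⌊log₂ n⌋ + 1` one has `2^k ≤ 2n`, and `k + 3 ≤ 2 log n + 4 ≤ (log n)²` once `log n ≥
4`. Each factor under the root thus at most doubles. -/
lemma lilRate_log_succ_le : ∀ᶠ n : ℕ in atTop,
    lilRate (Nat.log 2 n + 1) ≤ 2 * √(n * Real.log (Real.log n)) := by
  have h1 : Tendsto (fun n : ℕ => Real.log n) atTop atTop :=
    Real.tendsto_log_atTop.comp tendsto_natCast_atTop_atTop
  filter_upwards [h1.eventually_ge_atTop 4, eventually_ge_atTop 1] with n hn hn1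
  have hlog : (Nat.log 2 n : ℝ) * Real.log 2 ≤ Real.log n := by
    rw [← Real.log_pow]
    refine Real.log_le_log (by positivity) ?_
    exact_mod_cast Nat.pow_log_le_self 2 (by omega)
  have hl2 := Real.log_two_gt_d9
  have hle : (Nat.log 2 n : ℝ) ≤ 2 * Real.log n := by
    have : (0 : ℝ) ≤ Nat.log 2 n := Nat.cast_nonneg _
    nlinarith
  have hL : dyadicLog (Nat.log 2 n + 1) ≤ 2 * Real.log (Real.log n) := by
    have : 2 * Real.log (Real.log n) = Real.log (Real.log n ^ 2) := by
      rw [Real.log_pow]; norm_num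
    rw [this, dyadicLog]
    refine Real.log_le_log (by positivity) ?_
    push_cast
    nlinarith
  have hp : (2 : ℝ) ^ (Nat.log 2 n + 1) ≤ 2 * n := by
    rw [pow_succ, mul_comm]
    gcongr
    exact_mod_cast Nat.pow_log_le_self 2 (by omega)
  have h2 : (2 : ℝ) = √4 := by rw [show (4 : ℝ) = 2 ^ 2 by norm_num, Real.sqrt_sq (by norm_num)]
  rw [h2, ← Real.sqrt_mul (by norm_num), lilRate]
  refine Real.sqrt_le_sqrt ?_
  calc (2 : ℝ) ^ (Nat.log 2 n + 1) * dyadicLog (Nat.log 2 n + 1)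
      ≤ (2 * n) * (2 * Real.log (Real.log n)) :=
        mul_le_mul hp hL (dyadicLog_pos _).le (by positivity)
    _ = 4 * (n * Real.log (Real.log n)) := by ring

lemma eventually_of_dyadic {p : ℕ → ℕ → Prop}
    (h : ∀ᶠ k in atTop, ∀ n ≤ 2 ^ k, p k n) :
    ∀ᶠ n in atTop, p (Nat.log 2 n + 1) n := by
  obtain ⟨K, hK⟩ := eventually_atTop.mp h
  filter_upwards [eventually_ge_atTop (2 ^ K)] with n hn
  refine hK _ ?_ n (Nat.lt_pow_succ_log_self (by norm_num) n).le
  have := Nat.le_log_of_pow_le (by norm_num) hn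
  omega

lemma isBigO_of_dyadic {S : ℕ → ℝ} {C : ℝ}
    (h : ∀ᶠ k in atTop, ∀ n ≤ 2 ^ k, |S n| ≤ C * lilRate k) :
    S =O[atTop] fun n : ℕ => √(n * Real.log (Real.log n)) := by
  refine IsBigO.of_bound (|C| * 2) ?_
  filter_upwards [eventually_of_dyadic (p := fun k n => |S n| ≤ C * lilRate k) h,
    lilRate_log_succ_le] with n h1 h2
  rw [Real.norm_eq_abs, Real.norm_of_nonneg (Real.sqrt_nonneg _), mul_assoc]
  refine h1.trans ((mul_le_mul_of_nonneg_right (le_abs_self C) (lilRate_pos _).le).trans ?_)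
  gcongr

/-! ### Upper law of the iterated logarithm by dyadic truncation -/

section LIL

variable {Ω : Type*} [MeasurableSpace Ω] {P : Measure Ω}

/-- Truncation of a real number at `truncLevel k`. -/
def trunc (k : ℕ) (y : ℝ) : ℝ := if |y| ≤ truncLevel k then y else 0

lemma measurable_trunc (k : ℕ) : Measurable (trunc k) :=
  Measurable.ite (measurableSet_le measurable_abs measurable_const) measurable_id measurable_const

lemma abs_trunc_le (k : ℕ) (y : ℝ) : |trunc k y| ≤ truncLevel k := by
  rw [trunc]
  split_ifs with h
  · exact h
  · simpa using (truncLevel_pos k).le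

lemma abs_trunc_le_abs (k : ℕ) (y : ℝ) : |trunc k y| ≤ |y| := by
  rw [trunc]
  split_ifs with h <;> simp

lemma truncLevel_mul_abs_sub_trunc (k : ℕ) (y : ℝ) :
    truncLevel k * |y - trunc k y| = |y| * if truncLevel k < |y| then truncLevel k else 0 := by
  rw [trunc]
  by_cases h : |y| ≤ truncLevel k
  · simp [h, not_lt.mpr h]
  · simp [h, not_le.mp h, mul_comm]

lemma abs_sub_trunc_le (k : ℕ) (y : ℝ) : |y - trunc k y| ≤ |y| := by
  rw [trunc]
  split_ifs with h <;> simp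

/-- Exchange sum and expectation: the levels lying below `|Y|` sum to at most `8 |Y|`, so the series
is at most `8 E Y²`. This is where the second moment controls the truncated tails. -/
lemma summable_truncLevel_mul_integral [IsProbabilityMeasure P] {Y : Ω → ℝ}
    (hY : MemLp Y 2 P) :
    Summable fun k => truncLevel k * ∫ ω, |Y ω - trunc k (Y ω)| ∂P := by
  have hsq := hY.integrable_sq
  have hint : ∀ k, Integrable (fun ω => truncLevel k * |Y ω - trunc k (Y ω)|) P := fun k => by
    have hm : AEStronglyMeasurable (fun ω => trunc k (Y ω)) P :=
      ((measurable_trunc k).comp_aemeasurable hY.1.aemeasurable).aestronglyMeasurable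
    refine (Integrable.mono (hY.integrable (by norm_num)) (hY.1.sub hm).norm
      (ae_of_all _ fun ω => ?_)).const_mul _
    simpa using abs_sub_trunc_le k (Y ω)
  refine summable_of_sum_range_le (c := 8 * ∫ ω, Y ω ^ 2 ∂P) (fun k =>
    mul_nonneg (truncLevel_pos k).le (integral_nonneg fun ω => abs_nonneg _)) fun K => ?_
  simp_rw [← integral_const_mul]
  rw [← integral_finsetSum _ fun k _ => hint k]
  refine integral_mono (integrable_finsetSum _ fun k _ => hint k) (hsq.const_mul 8) fun ω => ?_
  simp only [truncLevel_mul_abs_sub_trunc, ← Finset.mul_sum]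
  calc _ ≤ |Y ω| * (8 * |Y ω|) := by
        gcongr
        exact sum_truncLevel_indicator_le (abs_nonneg _) K
    _ = 8 * Y ω ^ 2 := by rw [← sq_abs]; ring

lemma ae_eventually_abs_sum_centered_trunc_le [IsProbabilityMeasure P] {Y : ℕ → Ω → ℝ}
    (hY : ∀ i, Measurable (Y i)) (hind : iIndepFun Y P)
    (hid : ∀ i, IdentDistrib (Y i) (Y 0) P P) (hL2 : MemLp (Y 0) 2 P) :
    ∀ᵐ ω ∂P, ∀ᶠ k in atTop, ∀ n ≤ 2 ^ k,
      |∑ i ∈ Finset.range n, (trunc k (Y i ω) - ∫ ω', trunc k (Y 0 ω') ∂P)| ≤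
        ((∫ ω, Y 0 ω ^ 2 ∂P) / 2 + 4) * lilRate k := by
  set v := ∫ ω, Y 0 ω ^ 2 ∂P with hv
  have hv0 : 0 ≤ v := integral_nonneg fun ω => sq_nonneg _
  set c : ℕ → ℝ := fun k => ∫ ω, trunc k (Y 0 ω) ∂P with hc
  have htm : ∀ k i, Measurable fun ω => trunc k (Y i ω) := fun k i =>
    (measurable_trunc k).comp (hY i)
  have htint : ∀ k i, Integrable (fun ω => trunc k (Y i ω)) P := fun k i =>
    Integrable.of_bound (htm k i).aestronglyMeasurable (truncLevel k)
      (ae_of_all _ fun ω => abs_trunc_le _ _)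
  have hmean : ∀ k i, ∫ ω, (trunc k (Y i ω) - c k) ∂P = 0 := fun k i => by
    rw [integral_sub (htint k i) (integrable_const _)]
    have := ((hid i).comp (measurable_trunc k)).integral_eq
    simp only [Function.comp_apply] at this
    simp [this, hc]
  have hcb : ∀ k, |c k| ≤ truncLevel k := fun k => by
    have := norm_integral_le_of_norm_le_const (μ := P) (f := fun ω => trunc k (Y 0 ω))
      (ae_of_all _ fun ω => abs_trunc_le k (Y 0 ω))
    simpa using this
  have hbound : ∀ k i ω, |trunc k (Y i ω) - c k| ≤ 2 * truncLevel k := fun k i ω => by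
    have := abs_sub (trunc k (Y i ω)) (c k)
    linarith [abs_trunc_le k (Y i ω), hcb k]
  have hvar : ∀ k i, ∫ ω, (trunc k (Y i ω) - c k) ^ 2 ∂P ≤ v := fun k i => by
    have h1 := (((hid i).comp (measurable_trunc k)).sub_const (c k)).sq.integral_eq
    simp only [Function.comp_apply] at h1
    have hsqi : Integrable (fun ω => trunc k (Y 0 ω) ^ 2) P :=
      hL2.integrable_sq.mono ((htm k 0).pow_const 2).aestronglyMeasurable
        (ae_of_all _ fun ω => by
          simpa using pow_le_pow_left₀ (abs_nonneg _) (abs_trunc_le_abs k (Y 0 ω)) 2)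
    have h2 : ∫ ω, (trunc k (Y 0 ω) - c k) ^ 2 ∂P = ∫ ω, trunc k (Y 0 ω) ^ 2 ∂P - c k ^ 2 := by
      have e : ∀ ω, (trunc k (Y 0 ω) - c k) ^ 2 =
          trunc k (Y 0 ω) ^ 2 - (2 * c k * trunc k (Y 0 ω) - c k ^ 2) := fun ω => by ring
      simp_rw [e]
      rw [integral_sub (g := fun ω => 2 * c k * trunc k (Y 0 ω) - c k ^ 2) hsqi
          (((htint k 0).const_mul _).sub (integrable_const _)),
        integral_sub ((htint k 0).const_mul _) (integrable_const _), integral_const_mul]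
      simp only [integral_const, probReal_univ, one_smul, hc]
      ring
    rw [h1, h2]
    refine (sub_le_self _ (sq_nonneg _)).trans (integral_mono hsqi hL2.integrable_sq fun ω => ?_)
    exact sq_le_sq.mpr (abs_trunc_le_abs k _)
  -- Chosen so that, with `t = 1/(2 truncLevel k)`, the exponent is `L v/4 - A L/2 = -2 L`, where `L
  -- = log (k+3)`. The probabilities are then at most `(k+3)⁻²`, hence summable.
  set A := v / 2 + 4 with hA
  have hA0 : 0 < A := by positivity
  have hbasic : ∀ k (Z : ℕ → Ω → ℝ), (∀ i, Measurable (Z i)) → iIndepFun Z P →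
      (∀ i ω, |Z i ω| ≤ 2 * truncLevel k) → (∀ i, ∫ ω, Z i ω ∂P = 0) →
      (∀ i, ∫ ω, Z i ω ^ 2 ∂P ≤ v) →
      P {ω | ∃ n ≤ 2 ^ k, A * lilRate k ≤ ∑ i ∈ Finset.range n, Z i ω} ≤
        ENNReal.ofReal (((k : ℝ) + 3) ^ 2)⁻¹ := by
    intro k Z h1 h2 h3 h4 h5
    have hτ := truncLevel_pos k
    have := measure_exists_sum_ge_le_exp h1 h2 (t := 1 / (2 * truncLevel k)) (by positivity) h3
      (by field_simp; exact le_rfl) h4 h5 (2 ^ k) (mul_pos hA0 (lilRate_pos k))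
    refine this.trans (ENNReal.ofReal_le_ofReal ?_)
    have e : ((2 ^ k : ℕ) : ℝ) * ((1 / (2 * truncLevel k)) ^ 2 * v) -
        1 / (2 * truncLevel k) * (A * lilRate k) = -(2 * dyadicLog k) := by
      have h6 := lilRate_mul_truncLevel k
      rw [lilRate_eq] at h6 ⊢
      push_cast
      rw [← h6, hA]
      field_simp
      ring
    rw [e, Real.exp_neg, dyadicLog, two_mul, Real.exp_add, Real.exp_log (by positivity), sq]
  have hsum : ∑' k : ℕ, ENNReal.ofReal (((k : ℝ) + 3) ^ 2)⁻¹ ≠ ⊤ := by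
    refine Summable.tsum_ofReal_ne_top ?_
    have := (summable_nat_add_iff 3).mpr (Real.summable_nat_pow_inv.mpr (by norm_num : 1 < 2))
    simpa using this
  have hindZ : ∀ k, iIndepFun (fun i ω => trunc k (Y i ω) - c k) P := fun k =>
    hind.comp (fun _ y => trunc k y - c k) fun _ => (measurable_trunc k).sub_const _
  have hindZ' : ∀ k, iIndepFun (fun i ω => -(trunc k (Y i ω) - c k)) P := fun k =>
    hind.comp (fun _ y => -(trunc k y - c k)) fun _ => ((measurable_trunc k).sub_const _).neg
  have hup : ∀ᵐ ω ∂P, ∀ᶠ k in atTop, ω ∉ {ω | ∃ n ≤ 2 ^ k, A * lilRate k ≤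
      ∑ i ∈ Finset.range n, (trunc k (Y i ω) - c k)} := by
    refine ae_eventually_notMem (ne_top_of_le_ne_top hsum (ENNReal.tsum_le_tsum fun k => ?_))
    exact hbasic k _ (fun i => (htm k i).sub_const _) (hindZ k) (hbound k) (hmean k) (hvar k)
  have hlow : ∀ᵐ ω ∂P, ∀ᶠ k in atTop, ω ∉ {ω | ∃ n ≤ 2 ^ k, A * lilRate k ≤
      ∑ i ∈ Finset.range n, -(trunc k (Y i ω) - c k)} := by
    refine ae_eventually_notMem (ne_top_of_le_ne_top hsum (ENNReal.tsum_le_tsum fun k => ?_))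
    refine hbasic k _ (fun i => ((htm k i).sub_const _).neg) (hindZ' k)
      (fun i ω => by rw [abs_neg]; exact hbound k i ω) (fun i => ?_) (fun i => ?_)
    · rw [integral_neg, hmean, neg_zero]
    · simp_rw [neg_sq]; exact hvar k i
  filter_upwards [hup, hlow] with ω h1 h2
  filter_upwards [h1, h2] with k h1 h2 n hn
  simp only [not_exists, not_and, not_le, Finset.sum_neg_distrib] at h1 h2
  exact abs_le.mpr ⟨by linarith [h2 n hn], (h1 n hn).le⟩

/-- The upper half of the Hartman–Wintner law of the iterated logarithm, up to a constant. -/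
theorem isBigO_sum_lil [IsProbabilityMeasure P] {Y : ℕ → Ω → ℝ}
    (hY : ∀ i, Measurable (Y i)) (hind : iIndepFun Y P)
    (hid : ∀ i, IdentDistrib (Y i) (Y 0) P P) (hL2 : MemLp (Y 0) 2 P)
    (hmean : ∫ ω, Y 0 ω ∂P = 0) :
    ∀ᵐ ω ∂P, (fun n : ℕ => ∑ i ∈ Finset.range n, Y i ω) =O[atTop]
      fun n : ℕ => √(n * Real.log (Real.log n)) := by
  have hsum := summable_truncLevel_mul_integral hL2
  have htm : ∀ k i, Measurable fun ω => trunc k (Y i ω) := fun k i =>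
    (measurable_trunc k).comp (hY i)
  have hL1 : ∀ i, Integrable (Y i) P := fun i =>
    (hid i).integrable_iff.mpr (hL2.integrable (by norm_num))
  have hri : ∀ k i, Integrable (fun ω => |Y i ω - trunc k (Y i ω)|) P := fun k i =>
    Integrable.mono (hL1 i) ((hY i).sub (htm k i)).norm.aestronglyMeasurable
      (ae_of_all _ fun ω => by simpa using abs_sub_trunc_le k (Y i ω))
  set ρ : ℕ → ℝ := fun k => ∫ ω, |Y 0 ω - trunc k (Y 0 ω)| ∂P with hρ
  have hρ0 : ∀ k, 0 ≤ truncLevel k * ρ k := fun k =>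
    mul_nonneg (truncLevel_pos k).le (integral_nonneg fun ω => abs_nonneg _)
  have hρi : ∀ k i, ∫ ω, |Y i ω - trunc k (Y i ω)| ∂P = ρ k := fun k i => by
    have hm : Measurable fun y : ℝ => |y - trunc k y| :=
      (measurable_id.sub (measurable_trunc k)).norm
    exact ((hid i).comp hm).integral_eq
  set W : ℕ → Ω → ℝ := fun k ω =>
    (∑ i ∈ Finset.range (2 ^ k), |Y i ω - trunc k (Y i ω)|) / lilRate k with hW
  have hWint : ∀ k, Integrable (W k) P := fun k =>
    (integrable_finsetSum _ fun i _ => hri k i).div_const _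
  -- Since `lilRate k * truncLevel k = 2 ^ k`, the normalised tail sum over a block has exactly the
  -- summable expectation found above.
  have hEW : ∀ k, ∫ ω, W k ω ∂P = truncLevel k * ρ k := fun k => by
    simp only [hW]
    rw [integral_div, integral_finsetSum _ fun i _ => hri k i]
    simp only [hρi, Finset.sum_const, Finset.card_range, nsmul_eq_mul]
    push_cast
    rw [← lilRate_mul_truncLevel k]
    have := lilRate_pos k
    field_simp
  have hWle := ae_eventually_le_one_of_summable hWint (fun k ω =>
    div_nonneg (Finset.sum_nonneg fun i _ => abs_nonneg _) (lilRate_pos k).le)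
    (by simpa only [hEW] using hsum)
  -- As `Y 0` is centred, the mean of its truncation is minus the mean of the discarded part.
  have hc : ∀ k, |∫ ω, trunc k (Y 0 ω) ∂P| ≤ ρ k := fun k => by
    have hti : Integrable (fun ω => trunc k (Y 0 ω)) P :=
      Integrable.of_bound (htm k 0).aestronglyMeasurable (truncLevel k)
        (ae_of_all _ fun ω => abs_trunc_le _ _)
    have : ∫ ω, trunc k (Y 0 ω) ∂P = -∫ ω, (Y 0 ω - trunc k (Y 0 ω)) ∂P := by
      rw [integral_sub (hL1 0) hti, hmean]; ring
    rw [this, abs_neg]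
    exact abs_integral_le_integral_abs
  filter_upwards [hWle, ae_eventually_abs_sum_centered_trunc_le hY hind hid hL2] with ω h1 h2
  refine isBigO_of_dyadic
    (C := ((∫ ω, Y 0 ω ^ 2 ∂P) / 2 + 4) + (∑' k, truncLevel k * ρ k) + 1) ?_
  filter_upwards [h1, h2] with k h1 h2 n hn
  have hb := lilRate_pos k
  have e : ∑ i ∈ Finset.range n, Y i ω =
      ∑ i ∈ Finset.range n, (trunc k (Y i ω) - ∫ ω', trunc k (Y 0 ω') ∂P) +
      n * (∫ ω', trunc k (Y 0 ω') ∂P) + ∑ i ∈ Finset.range n, (Y i ω - trunc k (Y i ω)) := by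
    rw [Finset.sum_sub_distrib, Finset.sum_sub_distrib]
    simp
  have g2 : |(n : ℝ) * ∫ ω', trunc k (Y 0 ω') ∂P| ≤ (∑' k, truncLevel k * ρ k) * lilRate k := by
    rw [abs_mul, Nat.abs_cast]
    calc (n : ℝ) * |∫ ω', trunc k (Y 0 ω') ∂P| ≤ 2 ^ k * ρ k := by
          gcongr
          · exact_mod_cast hn
          · exact hc k
      _ = (truncLevel k * ρ k) * lilRate k := by rw [← lilRate_mul_truncLevel]; ring
      _ ≤ _ := by
          gcongr
          exact hsum.le_tsum k fun j _ => hρ0 j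
  have g3 : |∑ i ∈ Finset.range n, (Y i ω - trunc k (Y i ω))| ≤ lilRate k := by
    refine (Finset.abs_sum_le_sum_abs _ _).trans ?_
    rw [hW, div_le_one hb] at h1
    exact (Finset.sum_le_sum_of_subset_of_nonneg (Finset.range_mono hn)
      fun i _ _ => abs_nonneg _).trans h1
  rw [e]
  refine (abs_add_le _ _).trans ?_
  have := abs_add_le (∑ i ∈ Finset.range n, (trunc k (Y i ω) - ∫ ω', trunc k (Y 0 ω') ∂P))
    (n * (∫ ω', trunc k (Y 0 ω') ∂P))
  have := h2 n hn
  nlinarith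

end LIL

/-! ### Rademacher–Menshov maximal inequality -/

section RademacherMenshov

variable {Ω : Type*} [MeasurableSpace Ω] {P : Measure Ω}

/-- Dyadic chaining. The dominating function of a block is the sum of those of its two halves plus
the square of the full sum over the first half. A partial sum reaching into the second half is that
full sum plus a partial sum of the second half. -/
lemma exists_integrable_sq_partialSum_le {d : ℕ → Ω → ℝ} (hd : ∀ j, MemLp (d j) 2 P)
    {c : ℝ} {N : ℕ}
    (h : ∀ a n, a + n ≤ N → ∫ ω, (∑ j ∈ Finset.range n, d (a + j) ω) ^ 2 ∂P ≤ n * c) (k : ℕ) :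
    ∀ a, a + 2 ^ k ≤ N → ∃ Q : Ω → ℝ, Integrable Q P ∧ (∀ ω, 0 ≤ Q ω) ∧
      (∀ n ≤ 2 ^ k, ∀ ω, (∑ j ∈ Finset.range n, d (a + j) ω) ^ 2 ≤ (k + 1) * Q ω) ∧
      ∫ ω, Q ω ∂P ≤ (k + 1) * 2 ^ k * c := by
  induction k with
  | zero =>
    intro a ha
    refine ⟨fun ω => d a ω ^ 2, (hd a).integrable_sq, fun ω => sq_nonneg _, fun n hn ω => ?_, ?_⟩
    · have hn' : n ≤ 1 := by simpa using hn
      interval_cases n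
      · simpa using sq_nonneg (d a ω)
      · simp
    · simpa using h a 1 (by simpa using ha)
  | succ k ih =>
    intro a ha
    rw [pow_succ] at ha
    obtain ⟨Q₁, hi₁, h0₁, hb₁, he₁⟩ := ih a (by omega)
    obtain ⟨Q₂, hi₂, h0₂, hb₂, he₂⟩ := ih (a + 2 ^ k) (by omega)
    set x : Ω → ℝ := fun ω => ∑ j ∈ Finset.range (2 ^ k), d (a + j) ω with hx
    have hxm : MemLp x 2 P := memLp_finsetSum _ fun j _ => hd (a + j)
    have hxe : ∫ ω, x ω ^ 2 ∂P ≤ 2 ^ k * c := by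
      simpa using h a (2 ^ k) (by omega)
    refine ⟨fun ω => Q₁ ω + Q₂ ω + x ω ^ 2, (hi₁.add hi₂).add hxm.integrable_sq,
      fun ω => by have := h0₁ ω; have := h0₂ ω; positivity, fun n hn ω => ?_, ?_⟩
    · have := h0₁ ω
      have := h0₂ ω
      have hk : (0 : ℝ) ≤ k := k.cast_nonneg
      push_cast
      rcases le_or_gt n (2 ^ k) with hn' | hn'
      · refine (hb₁ n hn' ω).trans ?_
        nlinarith [sq_nonneg (x ω), mul_nonneg hk (h0₂ ω), mul_nonneg hk (sq_nonneg (x ω))]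
      · obtain ⟨m, rfl⟩ := Nat.exists_eq_add_of_le hn'.le
        rw [Finset.sum_range_add]
        have hy := hb₂ m (by rw [pow_succ] at hn; omega) ω
        simp only [add_assoc] at hy
        change (x ω + _) ^ 2 ≤ _
        set y := ∑ j ∈ Finset.range m, d (a + (2 ^ k + j)) ω
        have hk1 : (0 : ℝ) < k + 1 := by positivity
        -- Weighted Cauchy–Schwarz: `(x+y)² ≤ (k+2)(x² + y²/(k+1))`, combined with `y² ≤ (k+1) Q₂`.
        -- The weight makes the constant grow only linearly in `k`.
        have key : (k + 1) * (x ω + y) ^ 2 ≤ (k + 1) * ((k + 2) * (x ω ^ 2 + Q₂ ω)) := by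
          nlinarith [sq_nonneg ((k + 1) * x ω - y)]
        have := le_of_mul_le_mul_left key hk1
        nlinarith [mul_nonneg hk (h0₁ ω)]
    · rw [integral_add (f := fun ω => Q₁ ω + Q₂ ω) (hi₁.add hi₂) hxm.integrable_sq,
        integral_add hi₁ hi₂]
      -- This yields `0 ≤ 2^k c` without assuming `c ≥ 0`; it pays for the passage from `2k+3` to
      -- `2k+4`.
      have hx0 : 0 ≤ ∫ ω, x ω ^ 2 ∂P := integral_nonneg fun ω => sq_nonneg _
      push_cast
      rw [pow_succ]
      linarith

/-- The Rademacher–Menshov maximal inequality. -/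
lemma exists_integrable_sq_partialSum_le_of_orthogonal {d : ℕ → Ω → ℝ}
    (hd : ∀ j, MemLp (d j) 2 P) {c : ℝ} (k : ℕ)
    (horth : ∀ i j, i ≠ j → ∫ ω, d i ω * d j ω ∂P = 0)
    (hc : ∀ j < 2 ^ k, ∫ ω, d j ω ^ 2 ∂P ≤ c) :
    ∃ B : Ω → ℝ, Integrable B P ∧ (∀ ω, 0 ≤ B ω) ∧
      (∀ n ≤ 2 ^ k, ∀ ω, (∑ j ∈ Finset.range n, d j ω) ^ 2 ≤ B ω) ∧
      ∫ ω, B ω ∂P ≤ (k + 1) ^ 2 * 2 ^ k * c := by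
  have hint : ∀ i j, Integrable (fun ω => d i ω * d j ω) P := fun i j =>
    (hd i).integrable_mul (hd j)
  have h : ∀ a n, a + n ≤ 2 ^ k →
      ∫ ω, (∑ j ∈ Finset.range n, d (a + j) ω) ^ 2 ∂P ≤ n * c := by
    intro a n han
    simp_rw [sq, Finset.sum_mul_sum]
    rw [integral_finsetSum _ fun i _ => integrable_finsetSum _ fun j _ => hint _ _]
    have : ∀ i ∈ Finset.range n,
        ∫ ω, ∑ j ∈ Finset.range n, d (a + i) ω * d (a + j) ω ∂P ≤ c := by
      intro i hi
      rw [integral_finsetSum _ fun j _ => hint _ _, Finset.sum_eq_single_of_mem i hi]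
      · simp_rw [← sq]
        exact hc _ (by have := Finset.mem_range.mp hi; omega)
      · intro j _ hj
        exact horth _ _ (by omega)
    simpa using Finset.sum_le_card_nsmul _ _ _ this
  obtain ⟨Q, hQ, h0, hb, he⟩ := exists_integrable_sq_partialSum_le hd h k 0 (by simp)
  refine ⟨fun ω => (k + 1) * Q ω, hQ.const_mul _, fun ω => by have := h0 ω; positivity,
    fun n hn ω => by simpa using hb n hn ω, ?_⟩
  rw [integral_const_mul]
  have hk : (0 : ℝ) ≤ k + 1 := by positivity
  nlinarith [mul_le_mul_of_nonneg_left he hk]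

end RademacherMenshov

/-- A square-integrable kernel both of whose conditional means vanish. -/
structure IsDegenerate {𝓧 : Type*} [MeasurableSpace 𝓧] (μ : Measure 𝓧) (φ : 𝓧 → 𝓧 → ℝ) :
    Prop where
  measurable : Measurable (Function.uncurry φ)
  memLp : MemLp (Function.uncurry φ) 2 (μ.prod μ)
  integral_right : ∀ᵐ x ∂μ, ∫ y, φ x y ∂μ = 0
  integral_left : ∀ᵐ y ∂μ, ∫ x, φ x y ∂μ = 0

lemma IsDegenerate.flip {𝓧 : Type*} [MeasurableSpace 𝓧] {μ : Measure 𝓧} [SFinite μ]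
    {φ : 𝓧 → 𝓧 → ℝ} (h : IsDegenerate μ φ) : IsDegenerate μ (fun x y => φ y x) where
  measurable := h.measurable.comp measurable_swap
  memLp := h.memLp.comp_measurePreserving Measure.measurePreserving_swap
  integral_right := h.integral_left
  integral_left := h.integral_right

/-! ### Almost sure bounds for degenerate double sums -/

section Sample

variable {Ω 𝓧 : Type*} [MeasurableSpace Ω] [MeasurableSpace 𝓧] {P : Measure Ω}
  [IsProbabilityMeasure P] {X : ℕ → Ω → 𝓧}

lemma measurePreserving_pair (hX : ∀ i, Measurable (X i)) (hindep : iIndepFun X P)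
    (hident : ∀ i, IdentDistrib (X i) (X 0) P P) {i j : ℕ} (hij : i ≠ j) :
    MeasurePreserving (fun ω => (X i ω, X j ω)) P ((P.map (X 0)).prod (P.map (X 0))) := by
  refine ⟨(hX i).prodMk (hX j), ?_⟩
  rw [(indepFun_iff_map_prod_eq_prod_map_map (hX i).aemeasurable (hX j).aemeasurable).mp
    (hindep.indepFun hij), (hident i).map_eq, (hident j).map_eq]

lemma memLp_pair (hX : ∀ i, Measurable (X i)) (hindep : iIndepFun X P)
    (hident : ∀ i, IdentDistrib (X i) (X 0) P P) {φ : 𝓧 → 𝓧 → ℝ} {p : ENNReal}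
    (hφ : MemLp (Function.uncurry φ) p ((P.map (X 0)).prod (P.map (X 0)))) {i j : ℕ}
    (hij : i ≠ j) : MemLp (fun ω => φ (X i ω) (X j ω)) p P :=
  hφ.comp_measurePreserving (measurePreserving_pair hX hindep hident hij)

/-- The variable `X j` occurs only as the second argument of `φ` and is independent of the others,
so integrating it out first gives zero. All orthogonality relations below are instances, possibly
after flipping the kernels. -/
lemma integral_kernel_mul_eq_zero (hX : ∀ i, Measurable (X i)) (hindep : iIndepFun X P)
    (hident : ∀ i, IdentDistrib (X i) (X 0) P P) {φ χ : 𝓧 → 𝓧 → ℝ}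
    (hφ : IsDegenerate (P.map (X 0)) φ) (hχ : IsDegenerate (P.map (X 0)) χ)
    {i j a b : ℕ} (hij : j ≠ i) (hab : a ≠ b) (hja : j ≠ a) (hjb : j ≠ b) :
    ∫ ω, φ (X i ω) (X j ω) * χ (X a ω) (X b ω) ∂P = 0 := by
  set μ := P.map (X 0) with hμ
  have : IsProbabilityMeasure μ := Measure.isProbabilityMeasure_map (hX 0).aemeasurable
  -- `i` may coincide with `a` or `b`; indexing by a finite set treats all these cases at once.
  let S : Finset ℕ := {i, a, b}
  let V : Ω → S → 𝓧 := fun ω s => X s ω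
  have hV : Measurable V := measurable_pi_lambda _ fun s => hX s
  have hind : IndepFun V (X j) P := by
    have hdisj : Disjoint S {j} := by simp [S, hij, hja, hjb]
    exact (hindep.indepFun_finset S {j} hdisj hX).comp measurable_id
      (measurable_pi_apply (⟨j, by simp⟩ : ({j} : Finset ℕ)))
  have : IsProbabilityMeasure (P.map V) := Measure.isProbabilityMeasure_map hV.aemeasurable
  have hmap : P.map (fun ω => (V ω, X j ω)) = (P.map V).prod μ := by
    rw [(indepFun_iff_map_prod_eq_prod_map_map hV.aemeasurable (hX j).aemeasurable).mp hind,
      (hident j).map_eq]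
  let si : S := ⟨i, by simp [S]⟩
  let sa : S := ⟨a, by simp [S]⟩
  let sb : S := ⟨b, by simp [S]⟩
  let F : (S → 𝓧) × 𝓧 → ℝ := fun p => φ (p.1 si) p.2 * χ (p.1 sa) (p.1 sb)
  have hF : Measurable F := by
    refine Measurable.mul (hφ.measurable.comp (g := Function.uncurry φ)
      (f := fun p : (S → 𝓧) × 𝓧 => (p.1 si, p.2)) ?_)
      (hχ.measurable.comp (g := Function.uncurry χ)
      (f := fun p : (S → 𝓧) × 𝓧 => (p.1 sa, p.1 sb)) ?_) <;> fun_prop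
  have hVX : Measurable fun ω => (V ω, X j ω) := hV.prodMk (hX j)
  have hFint : Integrable F ((P.map V).prod μ) := by
    rw [← hmap, integrable_map_measure hF.aestronglyMeasurable hVX.aemeasurable]
    exact (memLp_pair hX hindep hident hφ.memLp hij.symm).integrable_mul
      (memLp_pair hX hindep hident hχ.memLp hab)
  have h1 : ∫ ω, φ (X i ω) (X j ω) * χ (X a ω) (X b ω) ∂P = ∫ p, F p ∂((P.map V).prod μ) := by
    rw [← hmap, integral_map hVX.aemeasurable hF.aestronglyMeasurable]
  have hpres : MeasurePreserving (fun v : S → 𝓧 => v si) (P.map V) μ := by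
    refine ⟨measurable_pi_apply si, ?_⟩
    rw [Measure.map_map (measurable_pi_apply si) hV]
    exact (hident i).map_eq
  rw [h1, integral_prod _ hFint]
  refine integral_eq_zero_of_ae ?_
  filter_upwards [hpres.quasiMeasurePreserving.ae hφ.integral_right] with v hv
  simp only [F, integral_mul_const, hv, zero_mul, Pi.zero_apply]

lemma summable_succ_sq_mul_geometric {r : ℝ} (h0 : 0 < r) (h1 : r < 1) :
    Summable fun k : ℕ => ((k : ℝ) + 1) ^ 2 * r ^ k := by
  have h := (summable_nat_add_iff 1).mpr
    (summable_pow_mul_geometric_of_norm_lt_one 2 (r := r) (by rwa [Real.norm_of_nonneg h0.le]))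
  refine (h.mul_right r⁻¹).congr fun k => ?_
  push_cast
  rw [pow_succ]
  field_simp
  ring

lemma integral_kernel_sq (hX : ∀ i, Measurable (X i)) (hindep : iIndepFun X P)
    (hident : ∀ i, IdentDistrib (X i) (X 0) P P) {φ : 𝓧 → 𝓧 → ℝ}
    (hφ : Measurable (Function.uncurry φ)) {i j : ℕ} (hij : i ≠ j) :
    ∫ ω, φ (X i ω) (X j ω) ^ 2 ∂P =
      ∫ p, Function.uncurry φ p ^ 2 ∂((P.map (X 0)).prod (P.map (X 0))) := by
  have h := measurePreserving_pair hX hindep hident hij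
  rw [← h.map_eq, integral_map h.measurable.aemeasurable (hφ.pow_const 2).aestronglyMeasurable]
  rfl

/-- The column sums `d j` are orthogonal with second moment `j c`. Rademacher–Menshov bounds the
expected maximum over a block by `(k+1)² 4^k c`, and division by `8^k` makes this summable. -/
lemma ae_eventually_sq_degenerate_sum_le (hX : ∀ i, Measurable (X i)) (hindep : iIndepFun X P)
    (hident : ∀ i, IdentDistrib (X i) (X 0) P P) {φ : 𝓧 → 𝓧 → ℝ}
    (hφ : IsDegenerate (P.map (X 0)) φ) :
    ∀ᵐ ω ∂P, ∀ᶠ k in atTop, ∀ n ≤ 2 ^ k,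
      (∑ j ∈ Finset.range n, ∑ i ∈ Finset.range j, φ (X i ω) (X j ω)) ^ 2 ≤ 8 ^ k := by
  have : IsProbabilityMeasure (P.map (X 0)) :=
    Measure.isProbabilityMeasure_map (hX 0).aemeasurable
  set c := ∫ p, Function.uncurry φ p ^ 2 ∂((P.map (X 0)).prod (P.map (X 0))) with hc
  have hc0 : 0 ≤ c := integral_nonneg fun _ => sq_nonneg _
  set d : ℕ → Ω → ℝ := fun j ω => ∑ i ∈ Finset.range j, φ (X i ω) (X j ω) with hd
  have hφm : ∀ i j, i ≠ j → MemLp (fun ω => φ (X i ω) (X j ω)) 2 P := fun i j hij =>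
    memLp_pair hX hindep hident hφ.memLp hij
  have hdm : ∀ j, MemLp (d j) 2 P := fun j =>
    memLp_finsetSum _ fun i hi => hφm i j (Finset.mem_range.mp hi).ne
  have hint : ∀ i j a b, i < j → a < b →
      Integrable (fun ω => φ (X i ω) (X j ω) * φ (X a ω) (X b ω)) P := fun i j a b hij hab =>
    (hφm i j hij.ne).integrable_mul (hφm a b hab.ne)
  have hexp : ∀ j j', ∫ ω, d j ω * d j' ω ∂P = ∑ i ∈ Finset.range j, ∑ a ∈ Finset.range j',
      ∫ ω, φ (X i ω) (X j ω) * φ (X a ω) (X j' ω) ∂P := fun j j' => by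
    simp only [hd, Finset.sum_mul_sum]
    rw [integral_finsetSum _ fun i hi => integrable_finsetSum _ fun a ha =>
      hint _ _ _ _ (Finset.mem_range.mp hi) (Finset.mem_range.mp ha)]
    refine Finset.sum_congr rfl fun i hi => ?_
    rw [integral_finsetSum _ fun a ha =>
      hint _ _ _ _ (Finset.mem_range.mp hi) (Finset.mem_range.mp ha)]
  have horth' : ∀ j j', j' < j → ∫ ω, d j ω * d j' ω ∂P = 0 := fun j j' hjj => by
    rw [hexp]
    refine Finset.sum_eq_zero fun i hi => Finset.sum_eq_zero fun a ha => ?_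
    have := Finset.mem_range.mp hi
    have := Finset.mem_range.mp ha
    exact integral_kernel_mul_eq_zero hX hindep hident hφ hφ (by omega) (by omega) (by omega)
      (by omega)
  have horth : ∀ j j', j ≠ j' → ∫ ω, d j ω * d j' ω ∂P = 0 := fun j j' hjj => by
    rcases lt_or_gt_of_ne hjj with h | h
    · simp_rw [mul_comm (d j _)]; exact horth' j' j h
    · exact horth' j j' h
  have hsq : ∀ j, ∫ ω, d j ω ^ 2 ∂P = j * c := fun j => by
    simp_rw [sq]
    rw [hexp]
    have : ∀ i ∈ Finset.range j, ∑ a ∈ Finset.range j,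
        ∫ ω, φ (X i ω) (X j ω) * φ (X a ω) (X j ω) ∂P = c := fun i hi => by
      have hi' := Finset.mem_range.mp hi
      rw [Finset.sum_eq_single_of_mem i hi]
      · simp_rw [← sq]
        exact integral_kernel_sq hX hindep hident hφ.measurable hi'.ne
      · intro a ha hai
        have := Finset.mem_range.mp ha
        -- Both terms share `X j`; it is the first argument `X i` that is integrated out, hence the
        -- flipped kernels.
        exact integral_kernel_mul_eq_zero hX hindep hident hφ.flip hφ.flip
          (i := j) (j := i) (a := j) (b := a) (by omega) (by omega) (by omega) (by omega)
    rw [Finset.sum_congr rfl this]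
    simp
  choose B hBi hB0 hBb hBe using fun k => exists_integrable_sq_partialSum_le_of_orthogonal
    (c := 2 ^ k * c) hdm k horth fun j hj => by
      rw [hsq]; gcongr; exact_mod_cast hj.le
  have hsum : Summable fun k => ∫ ω, B k ω / 8 ^ k ∂P := by
    refine Summable.of_nonneg_of_le (fun k => integral_nonneg fun ω => by
      have := hB0 k ω; positivity) (fun k => ?_)
      ((summable_succ_sq_mul_geometric (r := 1 / 2) (by norm_num) (by norm_num)).mul_left c)
    rw [integral_div, div_le_iff₀ (by positivity)]
    refine (hBe k).trans (le_of_eq ?_)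
    have : (8 : ℝ) ^ k = 2 ^ k * 2 ^ k * 2 ^ k := by rw [← mul_pow, ← mul_pow]; norm_num
    rw [this, one_div, inv_pow]
    field_simp
  filter_upwards [ae_eventually_le_one_of_summable (fun k => (hBi k).div_const _)
    (fun k ω => by have := hB0 k ω; positivity) hsum] with ω hω
  filter_upwards [hω] with k hk n hn
  rw [div_le_one (by positivity)] at hk
  exact (hBb k n hn ω).trans hk

/-- For fixed `i` the terms of the row sum are orthogonal over `j`. The maximal inequality is
applied to each row, and adding `2^k` rows gives expectation at most `(k+1)² 4^k c`, against the
normalisation `4^k √2^k = 2^{5k/2}`. -/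
lemma ae_eventually_sum_sq_degenerate_le (hX : ∀ i, Measurable (X i)) (hindep : iIndepFun X P)
    (hident : ∀ i, IdentDistrib (X i) (X 0) P P) {φ : 𝓧 → 𝓧 → ℝ}
    (hφ : IsDegenerate (P.map (X 0)) φ) :
    ∀ᵐ ω ∂P, ∀ᶠ k in atTop, ∀ n ≤ 2 ^ k,
      ∑ i ∈ Finset.range n, (∑ j ∈ (Finset.range n).erase i, φ (X i ω) (X j ω)) ^ 2 ≤
        4 ^ k * √2 ^ k := by
  set c := ∫ p, Function.uncurry φ p ^ 2 ∂((P.map (X 0)).prod (P.map (X 0))) with hc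
  have hc0 : 0 ≤ c := integral_nonneg fun _ => sq_nonneg _
  -- The diagonal term is replaced by 0, so that partial sums run over full initial segments.
  set d : ℕ → ℕ → Ω → ℝ := fun i j ω => if j = i then 0 else φ (X i ω) (X j ω) with hd
  have hdm : ∀ i j, MemLp (d i j) 2 P := fun i j => by
    by_cases hij : j = i
    · simp [hd, hij]
    · simp only [hd, hij, if_false]
      exact memLp_pair hX hindep hident hφ.memLp (Ne.symm hij)
  have horth : ∀ i j j', j ≠ j' → ∫ ω, d i j ω * d i j' ω ∂P = 0 := fun i j j' hjj => by
    by_cases h1 : j = i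
    · simp [hd, h1]
    by_cases h2 : j' = i
    · simp [hd, h2]
    simp only [hd, h1, h2, if_false]
    exact integral_kernel_mul_eq_zero hX hindep hident hφ hφ h1 (Ne.symm h2) h1 hjj
  have hsq : ∀ i j, ∫ ω, d i j ω ^ 2 ∂P ≤ c := fun i j => by
    by_cases h1 : j = i
    · simpa [hd, h1] using hc0
    simp only [hd, h1, if_false]
    exact (integral_kernel_sq hX hindep hident hφ.measurable (Ne.symm h1)).le
  choose B hBi hB0 hBb hBe using fun k i => exists_integrable_sq_partialSum_le_of_orthogonal
    (c := c) (hdm i) k (horth i) fun j _ => hsq i j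
  have hs2 : (0 : ℝ) < √2 := by positivity
  have hsum : Summable fun k =>
      ∫ ω, (∑ i ∈ Finset.range (2 ^ k), B k i ω) / (4 ^ k * √2 ^ k) ∂P := by
    refine Summable.of_nonneg_of_le (fun k => integral_nonneg fun ω =>
      div_nonneg (Finset.sum_nonneg fun i _ => hB0 k i ω) (by positivity)) (fun k => ?_)
      ((summable_succ_sq_mul_geometric (r := (√2)⁻¹) (by positivity)
        (inv_lt_one_of_one_lt₀ (Real.lt_sqrt_of_sq_lt (by norm_num)))).mul_left c)
    rw [integral_div, div_le_iff₀ (by positivity), integral_finsetSum _ fun i _ => hBi k i]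
    refine (Finset.sum_le_card_nsmul _ _ _ fun i _ => hBe k i).trans (le_of_eq ?_)
    have : (4 : ℝ) ^ k = 2 ^ k * 2 ^ k := by rw [← mul_pow]; norm_num
    rw [this, inv_pow]
    simp only [Finset.card_range, nsmul_eq_mul]
    push_cast
    field_simp
  filter_upwards [ae_eventually_le_one_of_summable
    (fun k => (integrable_finsetSum _ fun i _ => hBi k i).div_const _)
    (fun k ω => div_nonneg (Finset.sum_nonneg fun i _ => hB0 k i ω) (by positivity)) hsum]
    with ω hω
  filter_upwards [hω] with k hk n hn
  rw [div_le_one (by positivity)] at hk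
  refine le_trans ?_ hk
  calc _ ≤ ∑ i ∈ Finset.range n, B k i ω := by
        refine Finset.sum_le_sum fun i hi => ?_
        refine le_trans (le_of_eq ?_) (hBb k i n hn ω)
        congr 1
        rw [← Finset.sum_erase (a := i) (Finset.range n) (by simp [hd])]
        refine Finset.sum_congr rfl fun j hj => ?_
        simp [hd, Finset.ne_of_mem_erase hj]
    _ ≤ _ := Finset.sum_le_sum_of_subset_of_nonneg (Finset.range_mono hn) fun i _ _ => hB0 k i ω

lemma two_pow_log_succ_le {n : ℕ} (hn : n ≠ 0) : (2 : ℝ) ^ (Nat.log 2 n + 1) ≤ 2 * n := by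
  rw [pow_succ, mul_comm]
  gcongr
  exact_mod_cast Nat.pow_log_le_self 2 hn

lemma isBigO_degenerate_sum (hX : ∀ i, Measurable (X i)) (hindep : iIndepFun X P)
    (hident : ∀ i, IdentDistrib (X i) (X 0) P P) {φ : 𝓧 → 𝓧 → ℝ}
    (hφ : IsDegenerate (P.map (X 0)) φ) :
    ∀ᵐ ω ∂P, (fun n => ∑ j ∈ Finset.range n, ∑ i ∈ Finset.range j, φ (X i ω) (X j ω))
      =O[atTop] fun n : ℕ => (n : ℝ) * √n := by
  filter_upwards [ae_eventually_sq_degenerate_sum_le hX hindep hident hφ] with ω hω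
  -- Squaring, `8^k = (2^k)³ ≤ 8 n³ ≤ 9 n³`.
  refine IsBigO.of_bound 3 ?_
  filter_upwards [eventually_of_dyadic (p := fun k n => (∑ j ∈ Finset.range n,
    ∑ i ∈ Finset.range j, φ (X i ω) (X j ω)) ^ 2 ≤ 8 ^ k) hω, eventually_ne_atTop 0] with n h hn
  rw [Real.norm_eq_abs, Real.norm_of_nonneg (by positivity)]
  refine abs_le_of_sq_le_sq ?_ (by positivity)
  refine h.trans ?_
  have h8 : (8 : ℝ) = 2 ^ 3 := by norm_num
  rw [h8, ← pow_mul, mul_comm 3, pow_mul]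
  refine (pow_le_pow_left₀ (by positivity) (two_pow_log_succ_le hn) 3).trans ?_
  rw [mul_pow, mul_pow, mul_pow, Real.sq_sqrt (by positivity)]
  have : (0 : ℝ) ≤ (n : ℝ) ^ 3 := by positivity
  nlinarith

lemma isBigO_sum_sq_degenerate (hX : ∀ i, Measurable (X i)) (hindep : iIndepFun X P)
    (hident : ∀ i, IdentDistrib (X i) (X 0) P P) {φ : 𝓧 → 𝓧 → ℝ}
    (hφ : IsDegenerate (P.map (X 0)) φ) :
    ∀ᵐ ω ∂P, (fun n => ∑ i ∈ Finset.range n,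
      (∑ j ∈ (Finset.range n).erase i, φ (X i ω) (X j ω)) ^ 2)
      =O[atTop] fun n : ℕ => (n : ℝ) ^ 2 * √n := by
  filter_upwards [ae_eventually_sum_sq_degenerate_le hX hindep hident hφ] with ω hω
  refine IsBigO.of_bound (4 * √2) ?_
  filter_upwards [eventually_of_dyadic (p := fun k n => ∑ i ∈ Finset.range n,
      (∑ j ∈ (Finset.range n).erase i, φ (X i ω) (X j ω)) ^ 2 ≤ 4 ^ k * √2 ^ k) hω,
    eventually_ne_atTop 0] with n h hn
  rw [Real.norm_of_nonneg (Finset.sum_nonneg fun i _ => sq_nonneg _),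
    Real.norm_of_nonneg (by positivity)]
  refine h.trans ?_
  have h2 := two_pow_log_succ_le hn
  have e4 : ∀ k, (4 : ℝ) ^ k = (2 ^ k) ^ 2 := fun k => by
    rw [← pow_mul, mul_comm, pow_mul]; norm_num
  have e2 : ∀ k, √2 ^ k = √(2 ^ k) := fun k => by
    rw [eq_comm, Real.sqrt_eq_iff_mul_self_eq (by positivity) (by positivity), ← mul_pow,
      Real.mul_self_sqrt (by norm_num)]
  rw [e4, e2]
  calc _ ≤ (2 * (n : ℝ)) ^ 2 * √(2 * n) := by gcongr
    _ = _ := by rw [Real.sqrt_mul (by norm_num)]; ring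

end Sample

/-! ### Hoeffding decomposition of `h` and of the cross kernel -/

section Hoeffding

variable {𝓧 : Type*} [MeasurableSpace 𝓧] {μ : Measure 𝓧}

lemma holderTriple_four_four_two : ENNReal.HolderTriple 4 4 2 :=
  ⟨by rw [← two_mul, show (4 : ENNReal) = 2 * 2 by norm_num, ENNReal.mul_inv (by simp) (by simp),
    ← mul_assoc, ENNReal.mul_inv_cancel (by simp) (by simp), one_mul]⟩

/-- The projection `x ↦ E h(x, Y) - E h(X, Y)` for `X, Y` independent with law `μ`. -/
def proj (μ : Measure 𝓧) (h : 𝓧 → 𝓧 → ℝ) (x : 𝓧) : ℝ :=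
  ∫ y, h x y ∂μ - ∫ p, Function.uncurry h p ∂(μ.prod μ)

/-- The second-order remainder in the Hoeffding decomposition. -/
def remainder (μ : Measure 𝓧) (h : 𝓧 → 𝓧 → ℝ) (x y : 𝓧) : ℝ :=
  h x y - ∫ p, Function.uncurry h p ∂(μ.prod μ) - proj μ h x - proj μ h y

lemma remainder_symm {h : 𝓧 → 𝓧 → ℝ} (hs : ∀ x y, h x y = h y x) (x y : 𝓧) :
    remainder μ h x y = remainder μ h y x := by
  simp only [remainder, hs x y]; ring

variable [IsProbabilityMeasure μ]

/-- Averaging over `y` contracts `L^p`: on a probability space the `L¹` norm of a slice is at most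
its `L^p` norm, and Tonelli concludes. -/
lemma memLp_integral_right {φ : 𝓧 → 𝓧 → ℝ} {p : ENNReal} (hp1 : 1 ≤ p) (hp : p ≠ ⊤)
    (hφ : Measurable (Function.uncurry φ)) (hL : MemLp (Function.uncurry φ) p (μ.prod μ)) :
    MemLp (fun x => ∫ y, φ x y ∂μ) p μ := by
  have hp0 : p ≠ 0 := (one_pos.trans_le hp1).ne'
  have hpr : 0 < p.toReal := ENNReal.toReal_pos hp0 hp
  refine ⟨hφ.stronglyMeasurable.integral_prod_right'.aestronglyMeasurable, ?_⟩
  rw [eLpNorm_lt_top_iff_lintegral_rpow_enorm_lt_top hp0 hp]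
  have h1 := (eLpNorm_lt_top_iff_lintegral_rpow_enorm_lt_top hp0 hp).mp hL.2
  refine lt_of_le_of_lt ?_ h1
  rw [lintegral_prod _ (hφ.enorm.pow_const _).aemeasurable]
  refine lintegral_mono fun x => ?_
  have hx : Measurable (φ x) := hφ.comp measurable_prodMk_left
  have h2 : ‖∫ y, φ x y ∂μ‖ₑ ≤ eLpNorm (φ x) p μ := by
    refine (enorm_integral_le_lintegral_enorm _).trans ?_
    rw [← eLpNorm_one_eq_lintegral_enorm]
    exact eLpNorm_le_eLpNorm_of_exponent_le hp1 hx.aestronglyMeasurable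
  rw [eLpNorm_eq_lintegral_rpow_enorm_toReal hp0 hp] at h2
  refine (ENNReal.rpow_le_rpow h2 hpr.le).trans (le_of_eq ?_)
  rw [← ENNReal.rpow_mul, one_div, inv_mul_cancel₀ hpr.ne', ENNReal.rpow_one]
  rfl

variable {h : 𝓧 → 𝓧 → ℝ}

lemma measurable_proj (hm : Measurable (Function.uncurry h)) : Measurable (proj μ h) :=
  hm.stronglyMeasurable.integral_prod_right'.measurable.sub_const _

lemma measurable_remainder (hm : Measurable (Function.uncurry h)) :
    Measurable (Function.uncurry (remainder μ h)) :=
  ((hm.sub_const _).sub ((measurable_proj hm).comp measurable_fst)).sub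
    ((measurable_proj hm).comp measurable_snd)

lemma memLp_proj (hm : Measurable (Function.uncurry h))
    (hL : MemLp (Function.uncurry h) 4 (μ.prod μ)) : MemLp (proj μ h) 4 μ :=
  (memLp_integral_right (by norm_num) (by simp) hm hL).sub (memLp_const _)

lemma integral_proj (hL : MemLp (Function.uncurry h) 4 (μ.prod μ)) :
    ∫ x, proj μ h x ∂μ = 0 := by
  have hi : Integrable (Function.uncurry h) (μ.prod μ) := hL.integrable (by norm_num)
  have h1 : Integrable (fun x => ∫ y, h x y ∂μ) μ := hi.integral_prod_left
  have h2 := integral_prod _ hi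
  simp only [Function.uncurry_apply_pair] at h2
  simp only [proj]
  rw [integral_sub h1 (integrable_const _), ← h2]
  simp

lemma memLp_remainder (hm : Measurable (Function.uncurry h))
    (hL : MemLp (Function.uncurry h) 4 (μ.prod μ)) :
    MemLp (Function.uncurry (remainder μ h)) 4 (μ.prod μ) :=
  ((hL.sub (memLp_const _)).sub
    ((memLp_proj hm hL).comp_measurePreserving measurePreserving_fst)).sub
    ((memLp_proj hm hL).comp_measurePreserving measurePreserving_snd)

lemma integral_remainder_right (hm : Measurable (Function.uncurry h))
    (hL : MemLp (Function.uncurry h) 4 (μ.prod μ)) :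
    ∀ᵐ x ∂μ, ∫ y, remainder μ h x y ∂μ = 0 := by
  have hi : Integrable (Function.uncurry h) (μ.prod μ) := hL.integrable (by norm_num)
  have hg : Integrable (proj μ h) μ := (memLp_proj hm hL).integrable (by norm_num)
  filter_upwards [hi.prod_right_ae] with x hx
  simp only [Function.uncurry_apply_pair] at hx
  set θ := ∫ p, Function.uncurry h p ∂(μ.prod μ) with hθ
  have e : ∀ y, remainder μ h x y = h x y - (θ + proj μ h x + proj μ h y) := fun y => by
    simp only [remainder, ← hθ]; ring
  simp_rw [e]
  rw [integral_sub (g := fun y => θ + proj μ h x + proj μ h y) hx ((integrable_const _).add hg),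
    integral_add (integrable_const _) hg, integral_proj hL]
  simp [proj, ← hθ]

lemma isDegenerate_remainder (hm : Measurable (Function.uncurry h))
    (hs : ∀ x y, h x y = h y x) (hL : MemLp (Function.uncurry h) 4 (μ.prod μ)) :
    IsDegenerate μ (remainder μ h) where
  measurable := measurable_remainder hm
  memLp := (memLp_remainder hm hL).mono_exponent (by norm_num)
  integral_right := integral_remainder_right hm hL
  integral_left := by
    simp_rw [fun x y => remainder_symm (μ := μ) hs x y]
    exact integral_remainder_right hm hL

/-- The projection of the product kernel `g(x) ψ(x, y)` on its second argument. -/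
def crossProj (μ : Measure 𝓧) (h : 𝓧 → 𝓧 → ℝ) (y : 𝓧) : ℝ :=
  ∫ x, proj μ h x * remainder μ h x y ∂μ

/-- The degenerate part of the product kernel `g(x) ψ(x, y)`. -/
def crossKernel (μ : Measure 𝓧) (h : 𝓧 → 𝓧 → ℝ) (x y : 𝓧) : ℝ :=
  proj μ h x * remainder μ h x y - crossProj μ h y

lemma measurable_proj_mul_remainder (hm : Measurable (Function.uncurry h)) :
    Measurable (Function.uncurry fun x y => proj μ h x * remainder μ h x y) :=
  ((measurable_proj hm).comp measurable_fst).mul (measurable_remainder hm)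

/-- Hölder with exponents 4, 4, 2: the fourth moment of `h` makes the product square integrable. -/
lemma memLp_proj_mul_remainder (hm : Measurable (Function.uncurry h))
    (hL : MemLp (Function.uncurry h) 4 (μ.prod μ)) :
    MemLp (Function.uncurry fun x y => proj μ h x * remainder μ h x y) 2 (μ.prod μ) :=
  have := holderTriple_four_four_two
  (memLp_remainder hm hL).mul
    ((memLp_proj hm hL).comp_measurePreserving measurePreserving_fst)

lemma measurable_crossProj (hm : Measurable (Function.uncurry h)) :
    Measurable (crossProj μ h) :=
  ((measurable_proj_mul_remainder hm).comp
    measurable_swap).stronglyMeasurable.integral_prod_right'.measurable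

lemma memLp_crossProj (hm : Measurable (Function.uncurry h))
    (hL : MemLp (Function.uncurry h) 4 (μ.prod μ)) : MemLp (crossProj μ h) 2 μ :=
  memLp_integral_right (φ := fun y x => proj μ h x * remainder μ h x y) (by norm_num) (by simp)
    ((measurable_proj_mul_remainder hm).comp measurable_swap)
    ((memLp_proj_mul_remainder hm hL).comp_measurePreserving Measure.measurePreserving_swap)

lemma integral_proj_mul_remainder_right (hm : Measurable (Function.uncurry h))
    (hL : MemLp (Function.uncurry h) 4 (μ.prod μ)) :
    ∀ᵐ x ∂μ, ∫ y, proj μ h x * remainder μ h x y ∂μ = 0 := by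
  filter_upwards [integral_remainder_right hm hL] with x hx
  rw [integral_const_mul, hx, mul_zero]

/-- By Fubini `y` may be integrated first, which annihilates the remainder. -/
lemma integral_crossProj (hm : Measurable (Function.uncurry h))
    (hL : MemLp (Function.uncurry h) 4 (μ.prod μ)) : ∫ y, crossProj μ h y ∂μ = 0 := by
  have hi := (memLp_proj_mul_remainder hm hL).integrable (by norm_num)
  simp only [crossProj]
  rw [← integral_integral_swap hi]
  exact integral_eq_zero_of_ae (integral_proj_mul_remainder_right hm hL)

/-- The product already has vanishing mean in `y`, and subtracting the centred `crossProj` preserves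
this while removing the mean in `x`. -/
lemma isDegenerate_crossKernel (hm : Measurable (Function.uncurry h))
    (hL : MemLp (Function.uncurry h) 4 (μ.prod μ)) : IsDegenerate μ (crossKernel μ h) where
  measurable := (measurable_proj_mul_remainder hm).sub
    ((measurable_crossProj hm).comp measurable_snd)
  memLp := (memLp_proj_mul_remainder hm hL).sub
    ((memLp_crossProj hm hL).comp_measurePreserving measurePreserving_snd)
  integral_right := by
    have hi := (memLp_proj_mul_remainder hm hL).integrable (by norm_num)
    filter_upwards [integral_proj_mul_remainder_right hm hL, hi.prod_right_ae] with x h1 h2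
    simp only [Function.uncurry_apply_pair] at h2
    simp only [crossKernel]
    rw [integral_sub h2 ((memLp_crossProj hm hL).integrable (by norm_num)), h1,
      integral_crossProj hm hL, sub_zero]
  integral_left := by
    have hi := (memLp_proj_mul_remainder hm hL).integrable (by norm_num)
    filter_upwards [hi.prod_left_ae] with y h2
    simp only [Function.uncurry_apply_pair] at h2
    simp only [crossKernel]
    rw [integral_sub h2 (integrable_const _)]
    simp [crossProj]

end Hoeffding

/-! ### Algebraic expansion of the estimator -/

section Algebra

lemma sum_sum_erase_eq (F : ℕ → ℕ → ℝ) (n : ℕ) :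
    ∑ i ∈ Finset.range n, ∑ j ∈ (Finset.range n).erase i, F i j =
      ∑ j ∈ Finset.range n, ∑ i ∈ Finset.range j, (F i j + F j i) := by
  have h : ∀ n, ∑ i ∈ Finset.range n, ∑ j ∈ (Finset.range n).erase i, F i j =
      ∑ i ∈ Finset.range n, ∑ j ∈ Finset.range n, F i j - ∑ i ∈ Finset.range n, F i i := fun n => by
    rw [← Finset.sum_sub_distrib]
    exact Finset.sum_congr rfl fun i hi => Finset.sum_erase_eq_sub hi
  rw [h]
  induction n with
  | zero => simp
  | succ n ih =>
    rw [Finset.sum_range_succ (n := n) (f := fun j => ∑ i ∈ Finset.range j, (F i j + F j i)), ← ih]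
    simp only [Finset.sum_range_succ, Finset.sum_add_distrib]
    ring

variable {𝓧 : Type*}

lemma uStat_eq_mean {h : 𝓧 → 𝓧 → ℝ} (hs : ∀ x y, h x y = h y x) (x : ℕ → 𝓧) {n : ℕ}
    (hn : 2 ≤ n) :
    uStat h x n = (1 / (n : ℝ)) * ∑ i ∈ Finset.range n,
      ((1 / ((n : ℝ) - 1)) * ∑ j ∈ (Finset.range n).erase i, h (x i) (x j)) := by
  have h1 : (0 : ℝ) < (n : ℝ) - 1 := by
    have : (2 : ℝ) ≤ n := by exact_mod_cast hn
    linarith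
  have h2 : (0 : ℝ) < n := by linarith
  rw [← Finset.mul_sum, sum_sum_erase_eq (fun i j => h (x i) (x j)), uStat, Nat.cast_choose_two]
  simp_rw [fun i j => hs (x i) (x j), ← two_mul, ← Finset.mul_sum]
  field_simp

/-- The estimator is an empirical variance of row means `c + α g(x_i) + β R_i`, so the common
constant `c`, which carries `θ`, cancels. -/
lemma jackknifeVar_eq {h : 𝓧 → 𝓧 → ℝ} (hs : ∀ x y, h x y = h y x) (x : ℕ → 𝓧) {n : ℕ}
    (hn : 2 ≤ n) (θ : ℝ) (g : 𝓧 → ℝ) (ψ : 𝓧 → 𝓧 → ℝ)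
    (hψ : ∀ y z, h y z = θ + g y + g z + ψ y z) :
    jackknifeVar h x n =
      (((n : ℝ) - 2) / (n - 1)) ^ 2 * ((∑ i ∈ Finset.range n, g (x i) ^ 2) / n) +
      2 * (((n : ℝ) - 2) / (n - 1)) * ((∑ i ∈ Finset.range n, g (x i) *
        ∑ j ∈ (Finset.range n).erase i, ψ (x i) (x j)) / (n * (n - 1))) +
      (∑ i ∈ Finset.range n, (∑ j ∈ (Finset.range n).erase i, ψ (x i) (x j)) ^ 2) /
        (n * (n - 1) ^ 2) -
      (((n : ℝ) - 2) / (n - 1) * ((∑ i ∈ Finset.range n, g (x i)) / n) +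
        (∑ i ∈ Finset.range n, ∑ j ∈ (Finset.range n).erase i, ψ (x i) (x j)) /
          (n * (n - 1))) ^ 2 := by
  have h1 : (0 : ℝ) < (n : ℝ) - 1 := by
    have : (2 : ℝ) ≤ n := by exact_mod_cast hn
    linarith
  have h2 : (0 : ℝ) < n := by linarith
  set G := ∑ i ∈ Finset.range n, g (x i) with hG
  set R : ℕ → ℝ := fun i => ∑ j ∈ (Finset.range n).erase i, ψ (x i) (x j) with hR
  set α := ((n : ℝ) - 2) / (n - 1) with hα
  set c := θ + G / (n - 1) with hc
  set β := 1 / ((n : ℝ) - 1) with hβ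
  -- Row `i` contains `g(x_i)` itself with weight 1, while the sum over `j ≠ i` is `G - g(x_i)`,
  -- divided by `n-1`; hence `α = 1 - 1/(n-1)`.
  have hq : ∀ i ∈ Finset.range n,
      β * ∑ j ∈ (Finset.range n).erase i, h (x i) (x j) = c + α * g (x i) + β * R i := by
    intro i hi
    simp only [hψ, Finset.sum_add_distrib, Finset.sum_const, Finset.card_erase_of_mem hi,
      Finset.card_range, nsmul_eq_mul, Nat.cast_sub (show 1 ≤ n by omega), Nat.cast_one]
    rw [Finset.sum_erase_eq_sub hi, ← hG]
    change β * (_ + R i) = _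
    rw [hβ, hα, hc]
    field_simp
    ring
  rw [jackknifeVar, uStat_eq_mean hs x hn, Finset.sum_congr rfl hq,
    Finset.sum_congr rfl fun i hi => congrArg (· ^ 2) (hq i hi)]
  have e : ∀ i, (c + α * g (x i) + β * R i) ^ 2 = c ^ 2 + α ^ 2 * g (x i) ^ 2 +
      β ^ 2 * R i ^ 2 + 2 * c * α * g (x i) + 2 * c * β * R i + 2 * α * β * (g (x i) * R i) :=
    fun i => by ring
  simp only [e, Finset.sum_add_distrib, ← Finset.mul_sum, Finset.sum_const, Finset.card_range,
    nsmul_eq_mul, ← hG]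
  rw [hβ]
  clear_value G α c
  field_simp
  ring

end Algebra

/-! ### Comparison of rates -/

section Rate

lemma tendsto_natCast_log_log : Tendsto (fun n : ℕ => Real.log (Real.log n)) atTop atTop :=
  Real.tendsto_log_atTop.comp (Real.tendsto_log_atTop.comp tendsto_natCast_atTop_atTop)

lemma tendsto_lil_rate_zero :
    Tendsto (fun n : ℕ => √(Real.log (Real.log n) / n)) atTop (𝓝 0) := by
  rw [← Real.sqrt_zero]
  refine (Real.continuous_sqrt.tendsto 0).comp ?_
  have h1 : Tendsto (fun n : ℕ => Real.log (n : ℝ) / n) atTop (𝓝 0) :=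
    Real.isLittleO_log_id_atTop.tendsto_div_nhds_zero.comp tendsto_natCast_atTop_atTop
  refine squeeze_zero' ?_ ?_ h1
  · filter_upwards [tendsto_natCast_log_log.eventually_ge_atTop 0] with n hn
    positivity
  · filter_upwards [eventually_ge_atTop 1] with n hn
    exact div_le_div_of_nonneg_right (Real.log_le_self (Real.log_natCast_nonneg n)) n.cast_nonneg

/-- Eventually `log log n ≥ 1`. Hence bounds of order `n^{-1/2}` for the degenerate parts suffice.
-/
lemma isBigO_inv_sqrt_lil_rate :
    (fun n : ℕ => (√(n : ℝ))⁻¹) =O[atTop] fun n : ℕ => √(Real.log (Real.log n) / n) := by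
  refine IsBigO.of_bound 1 ?_
  filter_upwards [tendsto_natCast_log_log.eventually_ge_atTop 1] with n hn
  rw [one_mul, Real.norm_of_nonneg (by positivity), Real.norm_of_nonneg (by positivity),
    ← Real.sqrt_inv]
  refine Real.sqrt_le_sqrt ?_
  rw [inv_eq_one_div]
  gcongr

lemma isBigO_div_lil_rate {S : ℕ → ℝ}
    (hS : S =O[atTop] fun n : ℕ => √(n * Real.log (Real.log n))) :
    (fun n => S n / n) =O[atTop] fun n : ℕ => √(Real.log (Real.log n) / n) := by
  refine (hS.mul (isBigO_refl (fun n : ℕ => (n : ℝ)⁻¹) atTop)).congr' ?_ ?_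
  · exact Eventually.of_forall fun n => (div_eq_mul_inv _ _).symm
  · filter_upwards [eventually_gt_atTop 0] with n hn
    have hn' : (0 : ℝ) < n := by exact_mod_cast hn
    rw [Real.sqrt_mul hn'.le, Real.sqrt_div' _ hn'.le]
    have h := Real.mul_self_sqrt hn'.le
    have h0 : √(n : ℝ) ≠ 0 := (Real.sqrt_pos.mpr hn').ne'
    field_simp
    rw [sq, h]
    ring

lemma isBigO_inv_sub_one :
    (fun n : ℕ => ((n : ℝ) - 1)⁻¹) =O[atTop] fun n : ℕ => (n : ℝ)⁻¹ := by
  refine IsBigO.of_bound 2 ?_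
  filter_upwards [eventually_ge_atTop 2] with n hn
  have hn' : (2 : ℝ) ≤ n := by exact_mod_cast hn
  have h1 : (0 : ℝ) < (n : ℝ) - 1 := by linarith
  rw [Real.norm_of_nonneg (by positivity), Real.norm_of_nonneg (by positivity),
    inv_eq_one_div, inv_eq_one_div, mul_one_div, div_le_div_iff₀ h1 (by positivity)]
  linarith

lemma isBigO_inv_sub_one_lil_rate :
    (fun n : ℕ => ((n : ℝ) - 1)⁻¹) =O[atTop] fun n : ℕ => √(Real.log (Real.log n) / n) := by
  refine (isBigO_inv_sub_one.trans (IsBigO.of_bound 1 ?_)).trans isBigO_inv_sqrt_lil_rate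
  filter_upwards [eventually_ge_atTop 1] with n hn
  have hn' : (1 : ℝ) ≤ n := by exact_mod_cast hn
  rw [one_mul, Real.norm_of_nonneg (by positivity), Real.norm_of_nonneg (by positivity)]
  have : √(n : ℝ) ≤ n := Real.sqrt_le_iff.mpr ⟨by positivity, by nlinarith⟩
  gcongr

lemma isBigO_div_mul_sub_one {S : ℕ → ℝ} (hS : S =O[atTop] fun n : ℕ => (n : ℝ) * √n) :
    (fun n : ℕ => S n / (n * ((n : ℝ) - 1))) =O[atTop]
      fun n : ℕ => √(Real.log (Real.log n) / n) := by
  refine IsBigO.trans ?_ isBigO_inv_sqrt_lil_rate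
  refine ((hS.mul (isBigO_refl (fun n : ℕ => (n : ℝ)⁻¹) atTop)).mul isBigO_inv_sub_one).congr' ?_ ?_
  · exact Eventually.of_forall fun n => by simp only [div_eq_mul_inv, mul_inv, mul_assoc]
  · filter_upwards [eventually_gt_atTop 0] with n hn
    have hn' : (0 : ℝ) < n := by exact_mod_cast hn
    have h := Real.mul_self_sqrt hn'.le
    have h0 : √(n : ℝ) ≠ 0 := (Real.sqrt_pos.mpr hn').ne'
    field_simp
    rw [sq, h]

lemma isBigO_div_mul_sub_one_sq {S : ℕ → ℝ} (hS : S =O[atTop] fun n : ℕ => (n : ℝ) ^ 2 * √n) :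
    (fun n : ℕ => S n / (n * ((n : ℝ) - 1) ^ 2)) =O[atTop]
      fun n : ℕ => √(Real.log (Real.log n) / n) := by
  refine IsBigO.trans ?_ isBigO_inv_sqrt_lil_rate
  refine ((hS.mul (isBigO_refl (fun n : ℕ => (n : ℝ)⁻¹) atTop)).mul
    (isBigO_inv_sub_one.pow 2)).congr' ?_ ?_
  · exact Eventually.of_forall fun n => by simp only [div_eq_mul_inv, mul_inv, mul_assoc, inv_pow]
  · filter_upwards [eventually_gt_atTop 0] with n hn
    have hn' : (0 : ℝ) < n := by exact_mod_cast hn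
    have h := Real.mul_self_sqrt hn'.le
    have h0 : √(n : ℝ) ≠ 0 := (Real.sqrt_pos.mpr hn').ne'
    field_simp
    rw [sq, h]

end Rate

/-! ### Deterministic assembly of the rate -/

section Consistency

variable {𝓧 : Type*}

/-- Deterministic reduction of the rate of the jackknife variance estimator to the rates of the
sums in the Hoeffding decomposition. -/
lemma isBigO_jackknifeVar_sub {h : 𝓧 → 𝓧 → ℝ} (hs : ∀ x y, h x y = h y x) (x : ℕ → 𝓧)
    (θ v : ℝ) (g m : 𝓧 → ℝ) (ψ φ : 𝓧 → 𝓧 → ℝ)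
    (hψ : ∀ y z, h y z = θ + g y + g z + ψ y z) (hφ : ∀ y z, g y * ψ y z = φ y z + m z)
    (hg : (fun n => ∑ i ∈ Finset.range n, g (x i)) =O[atTop]
      fun n : ℕ => √(n * Real.log (Real.log n)))
    (hg2 : (fun n => ∑ i ∈ Finset.range n, (g (x i) ^ 2 - v)) =O[atTop]
      fun n : ℕ => √(n * Real.log (Real.log n)))
    (hm : (fun n => ∑ i ∈ Finset.range n, m (x i)) =O[atTop]
      fun n : ℕ => √(n * Real.log (Real.log n)))
    (hφ1 : (fun n => ∑ j ∈ Finset.range n, ∑ i ∈ Finset.range j, φ (x i) (x j))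
      =O[atTop] fun n : ℕ => (n : ℝ) * √n)
    (hφ2 : (fun n => ∑ j ∈ Finset.range n, ∑ i ∈ Finset.range j, φ (x j) (x i))
      =O[atTop] fun n : ℕ => (n : ℝ) * √n)
    (hψ1 : (fun n => ∑ j ∈ Finset.range n, ∑ i ∈ Finset.range j, ψ (x i) (x j))
      =O[atTop] fun n : ℕ => (n : ℝ) * √n)
    (hψ2 : (fun n => ∑ j ∈ Finset.range n, ∑ i ∈ Finset.range j, ψ (x j) (x i))
      =O[atTop] fun n : ℕ => (n : ℝ) * √n)
    (hψsq : (fun n => ∑ i ∈ Finset.range n,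
      (∑ j ∈ (Finset.range n).erase i, ψ (x i) (x j)) ^ 2)
      =O[atTop] fun n : ℕ => (n : ℝ) ^ 2 * √n) :
    (fun n => jackknifeVar h x n - v) =O[atTop]
      fun n : ℕ => √(Real.log (Real.log n) / n) := by
  have hα : (fun n : ℕ => ((n : ℝ) - 2) / (n - 1)) =O[atTop] fun _ : ℕ => (1 : ℝ) := by
    refine IsBigO.of_bound 1 ?_
    filter_upwards [eventually_ge_atTop 2] with n hn
    have hn' : (2 : ℝ) ≤ n := by exact_mod_cast hn
    rw [Real.norm_of_nonneg (div_nonneg (by linarith) (by linarith)),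
      div_le_iff₀ (by linarith), norm_one]
    linarith
  have hα2 : (fun n : ℕ => (((n : ℝ) - 2) / (n - 1)) ^ 2 - 1) =O[atTop]
      fun n : ℕ => √(Real.log (Real.log n) / n) := by
    have h1 : (fun n : ℕ => ((n : ℝ) - 2) / (n - 1) + 1) =O[atTop] fun _ : ℕ => (1 : ℝ) :=
      hα.add (isBigO_refl _ _)
    -- With `α = (n-2)/(n-1)`, `α² - 1 = (α - 1)(α + 1)` and `α - 1 = -1/(n-1)`.
    refine (isBigO_inv_sub_one_lil_rate.neg_left.mul h1).congr' ?_ (by simp)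
    filter_upwards [eventually_ge_atTop 2] with n hn
    have hn' : (2 : ℝ) ≤ n := by exact_mod_cast hn
    have h1 : (n : ℝ) - 1 ≠ 0 := by linarith
    field_simp
    ring
  have hcross : (fun n : ℕ => (∑ i ∈ Finset.range n, g (x i) *
      ∑ j ∈ (Finset.range n).erase i, ψ (x i) (x j)) / (n * ((n : ℝ) - 1))) =O[atTop]
      fun n : ℕ => √(Real.log (Real.log n) / n) := by
    refine ((isBigO_div_mul_sub_one (hφ1.add hφ2)).add (isBigO_div_lil_rate hm)).congr' ?_
      EventuallyEq.rfl
    filter_upwards [eventually_ge_atTop 2] with n hn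
    have hn' : (2 : ℝ) ≤ n := by exact_mod_cast hn
    have h1 : (n : ℝ) - 1 ≠ 0 := by linarith
    -- Each `m (x j)` is met once for every `i ≠ j`, hence the factor `n - 1`, which the
    -- normalisation cancels.
    have e : ∑ i ∈ Finset.range n, g (x i) * ∑ j ∈ (Finset.range n).erase i, ψ (x i) (x j) =
        (∑ j ∈ Finset.range n, ∑ i ∈ Finset.range j, φ (x i) (x j) +
        ∑ j ∈ Finset.range n, ∑ i ∈ Finset.range j, φ (x j) (x i)) +
        (n - 1) * ∑ i ∈ Finset.range n, m (x i) := by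
      simp only [Finset.mul_sum, hφ]
      simp_rw [Finset.sum_add_distrib]
      rw [sum_sum_erase_eq (fun i j => φ (x i) (x j)), ← Finset.sum_add_distrib]
      simp only [Finset.sum_add_distrib]
      congr 1
      rw [Finset.sum_congr rfl fun i hi => Finset.sum_erase_eq_sub (f := fun j => m (x j)) hi,
        Finset.sum_sub_distrib, ← Finset.mul_sum]
      simp
      ring
    rw [e]
    field_simp
  have hsum : (fun n : ℕ => (∑ i ∈ Finset.range n,
      ∑ j ∈ (Finset.range n).erase i, ψ (x i) (x j)) / (n * ((n : ℝ) - 1))) =O[atTop]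
      fun n : ℕ => √(Real.log (Real.log n) / n) := by
    refine (isBigO_div_mul_sub_one (hψ1.add hψ2)).congr_left fun n => ?_
    rw [sum_sum_erase_eq (fun i j => ψ (x i) (x j))]
    simp only [Finset.sum_add_distrib]
  have h1 : (fun n : ℕ => √(Real.log (Real.log n) / n)) =O[atTop] fun _ : ℕ => (1 : ℝ) :=
    tendsto_lil_rate_zero.isBigO_one ℝ
  have hlin : (fun n : ℕ => ((n : ℝ) - 2) / (n - 1) * ((∑ i ∈ Finset.range n, g (x i)) / n) +
      (∑ i ∈ Finset.range n, ∑ j ∈ (Finset.range n).erase i, ψ (x i) (x j)) /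
          (n * (n - 1))) =O[atTop] fun n : ℕ => √(Real.log (Real.log n) / n) := by
    refine IsBigO.add ?_ hsum
    simpa using hα.mul (isBigO_div_lil_rate hg)
  have hA := (hα.pow 2).mul (isBigO_div_lil_rate hg2)
  have hC := (hα.mul hcross).const_mul_left 2
  have hD := isBigO_div_mul_sub_one_sq hψsq
  -- The squared mean is the rate times a bounded factor, which is all that is needed.
  have hE := hlin.mul (hlin.trans h1)
  simp only [one_pow, one_mul, mul_one] at hA hC hE
  refine ((((hA.add (hα2.const_mul_left v)).add hC).add hD).sub hE).congr' ?_ EventuallyEq.rfl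
  filter_upwards [eventually_ge_atTop 2] with n hn
  have hn' : (2 : ℝ) ≤ n := by exact_mod_cast hn
  have hn0 : (n : ℝ) ≠ 0 := by linarith
  have e : (∑ i ∈ Finset.range n, (g (x i) ^ 2 - v)) / n =
      (∑ i ∈ Finset.range n, g (x i) ^ 2) / n - v := by
    rw [Finset.sum_sub_distrib, sub_div, Finset.sum_const, Finset.card_range, nsmul_eq_mul,
      mul_div_cancel_left₀ v hn0]
  rw [jackknifeVar_eq hs x hn θ g ψ hψ, e]
  ring

end Consistency

/-! ### Application to the i.i.d. sample -/

section Sample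

variable {Ω 𝓧 : Type*} [MeasurableSpace Ω] [MeasurableSpace 𝓧] {P : Measure Ω}
  [IsProbabilityMeasure P] {X : ℕ → Ω → 𝓧}

lemma memLp_four_of_integrable {h : 𝓧 → 𝓧 → ℝ} (hX : ∀ i, Measurable (X i))
    (hindep : iIndepFun X P) (hident : ∀ i, IdentDistrib (X i) (X 0) P P)
    (hmeas : Measurable (Function.uncurry h))
    (hmom : Integrable (fun ω => |h (X 0 ω) (X 1 ω)| ^ 4) P) :
    MemLp (Function.uncurry h) 4 ((P.map (X 0)).prod (P.map (X 0))) := by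
  have hp := measurePreserving_pair hX hindep hident zero_ne_one
  rw [← hp.map_eq, memLp_map_measure_iff hmeas.aestronglyMeasurable hp.measurable.aemeasurable,
    ← integrable_norm_rpow_iff (hmeas.comp hp.measurable).aestronglyMeasurable (by norm_num)
      (by simp)]
  have e : (4 : ENNReal).toReal = ((4 : ℕ) : ℝ) := by simp
  simp_rw [e, Real.rpow_natCast]
  exact hmom

lemma firstProj_eq_proj {h : 𝓧 → 𝓧 → ℝ} (hX : ∀ i, Measurable (X i))
    (hindep : iIndepFun X P) (hident : ∀ i, IdentDistrib (X i) (X 0) P P)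
    (hmeas : Measurable (Function.uncurry h)) (x : 𝓧) :
    firstProj P X h x = proj (P.map (X 0)) h x := by
  have hp := measurePreserving_pair hX hindep hident zero_ne_one
  have hx : Measurable (h x) := hmeas.comp measurable_prodMk_left
  rw [firstProj, theta, proj, ← hp.map_eq,
    integral_map hp.measurable.aemeasurable hmeas.aestronglyMeasurable, ← (hident 1).map_eq,
    integral_map (hX 1).aemeasurable hx.aestronglyMeasurable]
  rfl

/-- The law of the iterated logarithm bound for a centred square-integrable function of an i.i.d.
sample. -/
lemma isBigO_sum_comp (hX : ∀ i, Measurable (X i))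
    (hindep : iIndepFun X P) (hident : ∀ i, IdentDistrib (X i) (X 0) P P) {f : 𝓧 → ℝ}
    (hf : Measurable f) (hL : MemLp f 2 (P.map (X 0))) (h0 : ∫ x, f x ∂(P.map (X 0)) = 0) :
    ∀ᵐ ω ∂P, (fun n => ∑ i ∈ Finset.range n, f (X i ω)) =O[atTop]
      fun n : ℕ => √(n * Real.log (Real.log n)) := by
  refine isBigO_sum_lil (Y := fun i ω => f (X i ω)) (fun i => hf.comp (hX i))
    (hindep.comp (fun _ => f) fun _ => hf) (fun i => (hident i).comp hf)
    (hL.comp_measurePreserving ⟨hX 0, rfl⟩) ?_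
  rwa [integral_map (hX 0).aemeasurable hf.aestronglyMeasurable] at h0

lemma ae_isBigO_jackknifeVar_sub {h : 𝓧 → 𝓧 → ℝ} (hX : ∀ i, Measurable (X i))
    (hindep : iIndepFun X P) (hident : ∀ i, IdentDistrib (X i) (X 0) P P)
    (hmeas : Measurable (Function.uncurry h)) (hsymm : ∀ x y, h x y = h y x)
    (hmom : Integrable (fun ω => |h (X 0 ω) (X 1 ω)| ^ 4) P) :
    ∀ᵐ ω ∂P, (fun n : ℕ => jackknifeVar h (fun i => X i ω) n - sigmaSq P X h) =O[atTop]
      fun n : ℕ => √(Real.log (Real.log n) / n) := by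
  have hL := memLp_four_of_integrable hX hindep hident hmeas hmom
  have : IsProbabilityMeasure (P.map (X 0)) :=
    Measure.isProbabilityMeasure_map (hX 0).aemeasurable
  set μ := P.map (X 0) with hμ
  have := holderTriple_four_four_two
  have hgm : Measurable (proj μ h) := measurable_proj hmeas
  have hg := memLp_proj hmeas hL
  have hg2 : MemLp (fun x => proj μ h x ^ 2) 2 μ := by
    simp_rw [sq]; exact hg.mul hg
  have hσ : sigmaSq P X h = ∫ x, proj μ h x ^ 2 ∂μ := by
    have e : (fun ω => firstProj P X h (X 0 ω)) = fun ω => proj μ h (X 0 ω) :=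
      funext fun ω => firstProj_eq_proj hX hindep hident hmeas _
    have h0 := integral_proj hL
    rw [hμ, integral_map (hX 0).aemeasurable hgm.aestronglyMeasurable] at h0
    rw [sigmaSq, e, variance_of_integral_eq_zero (X := fun ω => proj μ h (X 0 ω))
      (hgm.comp (hX 0)).aemeasurable h0, hμ,
      integral_map (hX 0).aemeasurable (hgm.pow_const 2).aestronglyMeasurable]
  have hψ := isDegenerate_remainder hmeas hsymm hL
  have hφ := isDegenerate_crossKernel hmeas hL
  have hsq0 : ∫ x, (proj μ h x ^ 2 - sigmaSq P X h) ∂μ = 0 := by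
    rw [integral_sub (hg2.integrable (by norm_num)) (integrable_const _), hσ]
    simp
  filter_upwards [
    isBigO_sum_comp hX hindep hident hgm (hg.mono_exponent (by norm_num)) (integral_proj hL),
    isBigO_sum_comp hX hindep hident ((hgm.pow_const 2).sub_const (sigmaSq P X h))
      (hg2.sub (memLp_const _)) hsq0,
    isBigO_sum_comp hX hindep hident (measurable_crossProj hmeas) (memLp_crossProj hmeas hL)
      (integral_crossProj hmeas hL),
    -- The cross kernel need not be symmetric, so the sums over `i < j` are bounded in both
    -- orientations.
    isBigO_degenerate_sum hX hindep hident hφ, isBigO_degenerate_sum hX hindep hident hφ.flip,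
    isBigO_degenerate_sum hX hindep hident hψ, isBigO_degenerate_sum hX hindep hident hψ.flip,
    isBigO_sum_sq_degenerate hX hindep hident hψ] with ω h1 h2 h3 h4 h5 h6 h7 h8
  exact isBigO_jackknifeVar_sub hsymm _ (∫ p, Function.uncurry h p ∂(μ.prod μ)) _ _ _ _ _
    (fun y z => by rw [remainder]; ring) (fun y z => by rw [crossKernel]; ring)
    h1 h2 h3 h4 h5 h6 h7 h8

end Sample

end JackknifeU

end

theorem theorem2 {Ω 𝓧 : Type*} [MeasurableSpace Ω] [MeasurableSpace 𝓧]
    (P : Measure Ω) [IsProbabilityMeasure P]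
    (X : ℕ → Ω → 𝓧) (hX : ∀ i, Measurable (X i))
    (hindep : iIndepFun X P) (hident : ∀ i, IdentDistrib (X i) (X 0) P P)
    (h : 𝓧 → 𝓧 → ℝ) (hmeas : Measurable (Function.uncurry h))
    (hsymm : ∀ x y, h x y = h y x)
    (hmom : Integrable (fun ω => |h (X 0 ω) (X 1 ω)| ^ 4) P) :
    (∀ᵐ ω ∂P, Tendsto (fun n : ℕ => JackknifeU.jackknifeVar h (fun i => X i ω) n)
      atTop (𝓝 (JackknifeU.sigmaSq P X h))) ∧
    (∀ᵐ ω ∂P,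
      (fun n : ℕ => |JackknifeU.jackknifeVar h (fun i => X i ω) n - JackknifeU.sigmaSq P X h|)
        =O[atTop] (fun n : ℕ => Real.sqrt (Real.log (Real.log (n : ℝ)) / (n : ℝ)))) := by
  have hO := JackknifeU.ae_isBigO_jackknifeVar_sub hX hindep hident hmeas hsymm hmom
  refine ⟨?_, ?_⟩
  · filter_upwards [hO] with ω hω
    exact tendsto_sub_nhds_zero_iff.mp (hω.trans_tendsto JackknifeU.tendsto_lil_rate_zero)
  · filter_upwards [hO] with ω hω
    exact hω.abs_left
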